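/- Let $\mathcal X$ be a data domain and $\mathcal Q$ a class of statistical queries $q:\mathcal X\to\{0,1\}$. A perfect (weighted optimization) oracle $\mathcal O^*$ maps every finite weighted data set $WD=((x_i,w_i))_i\in(\mathcal X\times\mathbb R)^*$ to a query in $\operatorname{argmin}_{q\in\mathcal Q}\sum_i w_i q(x_i)$; we assume that a perfect oracle exists. A certifiable heuristic oracle $\mathcal O$ maps every such $WD$ either to an element of this argmin or to the failure symbol $\bot$. An oracle-dependent algorithm $\mathcal A_{\mathcal O}$ draws a random seed and then makes finitely many, possibly adaptive, oracle calls before it outputs an element of a set $\mathcal M$; its output is $\bot$ as soon as one of its oracle calls fails. (All algorithms and oracles are measurable.) Two data sets in $\mathcal X^n$ are neighbors if they differ in one entry. A randomized algorithm $P$ is $(\varepsilon,\delta)$-differentially private if $\Pr[P(S)\in E]\le e^{\varepsilon}\Pr[P(S')\in E]+\delta$ for all $n$, all neighbors $S,S'\in\mathcal X^n$ and all events $E$; it is $\varepsilon$-differentially private if this holds with $\delta=0$. Let $(\mathcal A^{\varepsilon'})_{\varepsilon'>0}$ be oracle-dependent algorithms, defined on data sets of every size, such that each $\mathcal A^{\varepsilon'}$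 is non-robustly $\varepsilon'$-differentially private: there is an $\varepsilon'$-differentially private algorithm with values in $\mathcal M$ that has the same output distribution as $\mathcal A^{\varepsilon'}_{\mathcal O^*}$ for every perfect oracle $\mathcal O^*$. Let $\mathcal O$ be an arbitrary certifiable heuristic oracle. For $\varepsilon_0,\delta_0>0$, the Private Robust Subsampling Meta Algorithm (PRSMA) with parameters $(\varepsilon_0,\delta_0)$ does the following on input $S\in\mathcal X^n$: 1. Let $K=\lceil\frac1{\varepsilon_0}(1+\log\frac2{\delta_0})\rceil$. Arrange $S$ in uniformly random order, discard $n\bmod K$ elements, and cut the rest into $K$ blocks $S_1,\dots,S_K$ of size $\lfloor n/K\rfloor$. 2. With $\varepsilon'=1/\sqrt{8\frac nK\log(2K/\delta_0)}$, for every $i\le K$ and every $t\le\lceil\log(K/\delta_0)/\delta_0\rceil$ compute, independently, $a_{it}=\mathcal A^{\varepsilon'}_{\mathcal O}(S_i)$. Block $i$ passes if $a_{it}\ne\bot$ for all $t$. 3. Let $T$ be the number of passing blocks and $\tilde T=T+z$ with independent Laplace noise $z$ of scale $1/\varepsilon_0$. If $\tilde T\le\frac1{\varepsilon_0}(1+\log\frac1{\delta_0})$,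 or if no block passes, output $\bot$. Otherwise choose a pair $(i,t)$ with $i$ passing uniformly at random and output $a_{it}$. Then, for all $\varepsilon,\delta>0$ with $\varepsilon^*=\frac{\varepsilon}{62}\le\frac12$ and $\delta^*=\frac{\delta}{11}\le\frac12$, PRSMA run with parameters $(\varepsilon^*,\delta^*)$ is $(\varepsilon,\delta)$-differentially private as an algorithm with values in $\mathcal M\cup\{\bot\}$. -/

import Mathlib

open MeasureTheory
open scoped ENNReal

noncomputable section

/-! ### Outputs that may be the failure symbol -/

/-- `Option α` is `α` together with the failure symbol `none`; a set is measurable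
iff its trace on `α` is measurable (so `{none}` is measurable). -/
instance optionMeasurableSpace {α : Type*} [MeasurableSpace α] : MeasurableSpace (Option α) :=
  MeasurableSpace.map some inferInstance

/-! ### Data sets and differential privacy -/

/-- Two data sets of the same size are neighbors if one is obtained from the other by
replacing (at most) one data point. -/
def Neighbors {X : Type*} {k : ℕ} (S S' : Fin k → X) : Prop :=
  ∃ i, ∀ j, j ≠ i → S j = S' j

/-- A randomized algorithm on data sets of every size, given by its output distributions. -/
abbrev Mechanism (X α : Type*) [MeasurableSpace α] : Type _ :=
  ∀ k : ℕ, (Fin k → X) → Measure α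

/-- `(ε, δ)`-differential privacy. -/
def IsDifferentiallyPrivate {X α : Type*} [MeasurableSpace α] (ε δ : ℝ)
    (P : Mechanism X α) : Prop :=
  ∀ (k : ℕ) (S S' : Fin k → X), Neighbors S S' → ∀ E : Set α, MeasurableSet E →
    P k S E ≤ ENNReal.ofReal (Real.exp ε) * P k S' E + ENNReal.ofReal δ

/-! ### Weighted optimization oracles

A class of statistical queries is an indexed family `ev : Q → X → Bool`; the case of a set `C` of
functions is `Q = ↥C` with `ev = Subtype.val`. -/

/-- Finite weighted data sets, i.e. elements of `(X × ℝ)^*`. -/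
abbrev WeightedDataset (X : Type*) : Type _ := Σ k : ℕ, (Fin k → X × ℝ)

/-- The weighted sum `∑ w_i q(x_i)`. -/
def weightedCost {X Q : Type*} (ev : Q → X → Bool) (q : Q) (wd : WeightedDataset X) : ℝ :=
  ∑ i, (wd.2 i).2 * (if ev q (wd.2 i).1 then 1 else 0)

/-- `q` minimizes the weighted sum over the whole class. -/
def IsMinimizer {X Q : Type*} (ev : Q → X → Bool) (wd : WeightedDataset X) (q : Q) : Prop :=
  ∀ q' : Q, weightedCost ev q wd ≤ weightedCost ev q' wd

/-- A (perfect) weighted optimization oracle. -/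
def IsPerfectOracle {X Q : Type*} (ev : Q → X → Bool) (O : WeightedDataset X → Q) : Prop :=
  ∀ wd, IsMinimizer ev wd (O wd)

/-- A certifiable heuristic oracle: it may fail (`none`), but any query it returns is a
minimizer. -/
def IsCertifiableOracle {X Q : Type*} (ev : Q → X → Bool)
    (O : WeightedDataset X → Option Q) : Prop :=
  ∀ wd q, O wd = some q → IsMinimizer ev wd q

/-! ### Oracle-dependent algorithms -/

/-- A deterministic computation making finitely many adaptive oracle calls: it either returns an
output, or submits a weighted data set and continues depending on the query it receives. -/
inductive OracleProgram (X Q M : Type*)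
  | output (m : M) : OracleProgram X Q M
  | call (wd : WeightedDataset X) (next : Q → OracleProgram X Q M) : OracleProgram X Q M

/-- The result of a run with the oracle `O`: the run fails as soon as an oracle call fails. -/
def OracleProgram.run {X Q M : Type*} (O : WeightedDataset X → Option Q) :
    OracleProgram X Q M → Option M
  | .output m => some m
  | .call wd next => (O wd).elim none (fun q => (next q).run O)

/-- A randomized oracle-dependent algorithm on data sets of size `k`: it draws a random seed, and
is then a deterministic computation with adaptive oracle calls. The last field is the technical
requirement that its output is a random variable, whatever (measurable) oracle is used. -/
structure OracleAlgorithm.{u, v, w, s} (X : Type u) (Q : Type v) (M : Type w)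
    [MeasurableSpace X] [MeasurableSpace Q] [MeasurableSpace M] (k : ℕ) where
  Seed : Type s
  [seedSpace : MeasurableSpace Seed]
  seedLaw : Measure Seed
  [seedProb : IsProbabilityMeasure seedLaw]
  program : Seed → (Fin k → X) → OracleProgram X Q M
  measurable_run : ∀ O : WeightedDataset X → Option Q, Measurable O →
    ∀ S, Measurable fun ω => (program ω S).run O

/-- The output distribution of an oracle-dependent algorithm run with the oracle `O` on `S`. -/
def OracleAlgorithm.law {X Q M : Type*} [MeasurableSpace X] [MeasurableSpace Q]
    [MeasurableSpace M] {k : ℕ} (A : OracleAlgorithm X Q M k)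
    (O : WeightedDataset X → Option Q) (S : Fin k → X) : Measure (Option M) :=
  letI := A.seedSpace
  A.seedLaw.map fun ω => (A.program ω S).run O

/-- With any perfect oracle, `A` has the same output distribution as `P`. -/
def OracleEquivalent {X Q M : Type*} [MeasurableSpace X] [MeasurableSpace Q] [MeasurableSpace M]
    (ev : Q → X → Bool) (A : ∀ k, OracleAlgorithm X Q M k) (P : Mechanism X M) : Prop :=
  ∀ O : WeightedDataset X → Q, Measurable O → IsPerfectOracle ev O →
    ∀ k S, (A k).law (fun wd => some (O wd)) S = (P k S).map some

/-- `A` is non-robustly `ε`-differentially private: it is oracle equivalent to an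
`ε`-differentially private algorithm. -/
def IsNonRobustlyPrivate {X Q M : Type*} [MeasurableSpace X] [MeasurableSpace Q]
    [MeasurableSpace M] (ev : Q → X → Bool) (ε : ℝ) (A : ∀ k, OracleAlgorithm X Q M k) : Prop :=
  ∃ P : Mechanism X M, IsDifferentiallyPrivate ε 0 P ∧ OracleEquivalent ev A P

/-! ### The private robust subsampling meta algorithm -/

/-- The Laplace distribution centered at `0` with scale `b`. -/
def laplaceMeasure (b : ℝ) : Measure ℝ :=
  volume.withDensity fun z => ENNReal.ofReal (1 / (2 * b) * Real.exp (-|z| / b))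

/-- The uniform mixture of a (nonempty) finite family of distributions. -/
def uniformMixture {ι α : Type*} [MeasurableSpace α] (s : Finset ι) (ν : ι → Measure α) :
    Measure α :=
  (s.card : ℝ≥0∞)⁻¹ • ∑ i ∈ s, ν i

namespace PRSMA

/-- The number of blocks, `K = (1/ε)(1 + log(2/δ))`, rounded up. -/
def numBlocks (ε δ : ℝ) : ℕ := ⌈1 / ε * (1 + Real.log (2 / δ))⌉₊

/-- The number of runs on each block, `log(K/δ)/δ`, rounded up. -/
def numRuns (ε δ : ℝ) : ℕ := ⌈Real.log (numBlocks ε δ / δ) / δ⌉₊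

/-- The privacy parameter `ε' = 1 / √(8 (n/K) log(2K/δ))` of the base algorithm. -/
def innerEps (ε δ : ℝ) (n : ℕ) : ℝ :=
  1 / √(8 * ((n : ℝ) / numBlocks ε δ) * Real.log (2 * numBlocks ε δ / δ))

theorem block_index_lt {n K : ℕ} (i : Fin K) (j : Fin (n / K)) :
    (i : ℕ) * (n / K) + j < n :=
  calc (i : ℕ) * (n / K) + j < (i : ℕ) * (n / K) + n / K := by omega
    _ = ((i : ℕ) + 1) * (n / K) := by ring
    _ ≤ K * (n / K) := Nat.mul_le_mul_right _ i.2
    _ ≤ n := Nat.mul_div_le n K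

/-- The `i`-th of `K` blocks of size `⌊n/K⌋` when the data set is arranged in the order `σ`; the
last `n mod K` elements of the arrangement are discarded. -/
def block {X : Type*} {n : ℕ} (K : ℕ) (S : Fin n → X) (σ : Equiv.Perm (Fin n)) (i : Fin K) :
    Fin (n / K) → X :=
  fun j => S (σ ⟨i * (n / K) + j, block_index_lt i j⟩)

open Classical in
/-- The blocks `i` with `o_i ≠ ⊥`: no run on them has failed. -/
def passing {M : Type*} {K R : ℕ} (a : Fin K × Fin R → Option M) : Finset (Fin K) :=
  Finset.univ.filter fun i => ∀ t, a (i, t) ≠ none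

open Classical in
/-- The final steps, given the results `a` of all runs and the Laplace noise `z`: if the noisy
number of passing blocks exceeds the threshold, a uniformly random result among those of all runs
on passing blocks is output; otherwise (or if there is no such result) the output is `none`. -/
def release {M : Type*} [MeasurableSpace M] {K R : ℕ} (ε δ : ℝ) (a : Fin K × Fin R → Option M)
    (z : ℝ) : Measure (Option M) :=
  if 1 / ε * (1 + Real.log (1 / δ)) < ((passing a).card : ℝ) + z ∧
      (passing a ×ˢ (Finset.univ : Finset (Fin R))).Nonempty then
    uniformMixture (passing a ×ˢ (Finset.univ : Finset (Fin R))) fun p => Measure.dirac (a p)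
  else Measure.dirac none

/-- The output distribution of the meta algorithm with parameters `ε, δ`, base algorithm
`A ε'` and oracle `O`: a uniformly random partition into blocks, independent runs of `A ε'` on the
blocks, independent Laplace noise of scale `1/ε`, and the final steps. -/
def mechanism {X Q M : Type*} [MeasurableSpace X] [MeasurableSpace Q] [MeasurableSpace M]
    (A : ℝ → ∀ k, OracleAlgorithm X Q M k) (O : WeightedDataset X → Option Q) (ε δ : ℝ) :
    Mechanism X (Option M) :=
  fun n S =>
    uniformMixture (Finset.univ : Finset (Equiv.Perm (Fin n))) fun σ =>
      ((Measure.pi fun p : Fin (numBlocks ε δ) × Fin (numRuns ε δ) =>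
          (A (innerEps ε δ n) (n / numBlocks ε δ)).law O (block (numBlocks ε δ) S σ p.1)).prod
        (laplaceMeasure (1 / ε))).bind fun y => release ε δ y.1 y.2

end PRSMA

end

/-! Use the same arrangement `σ` for both neighbors `S` and `S'`; then they differ in at most one
block `c`. A certifiable oracle may fail in a data-dependent way, so nothing relates the runs on `c`
for `S` to those for `S'`. Instead both output distributions are compared with a quantity that
ignores `c` (`eventProbErase`).

Ignoring `c` changes the number of passing blocks by at most one. The Laplace noise absorbs this at
a multiplicative cost `e ^ O(ε)`, and when at most about `1/ε` blocks pass the output is almost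
surely `⊥`. What remains is the chance that the released result comes from `c` itself. Its weight is
`1/T ≤ ε`, but an additive error of order `ε` is not allowed: the chance that `c` produces the event
must be bounded by the average chance over the other passing blocks, which is part of the output
probability already.

The comparison of blocks comes from random subsampling (`exists_reference`). By pure privacy of the
base algorithm, the log-density of its output law at a point `x` is a bounded-difference function of
the sampled positions. By a concentration inequality for random permutations (`sum_perm_exp_le`) it
is close, for a random block, to its mean `A x`, which is the same for every block. Hence each block
law agrees with the reference density `exp (A x)` up to a constant factor and additive errors that
are small on average over `σ`. The constant factor is affordable because it multiplies a term of
weight `ε`.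

Two facts link this ideal law to runs with failures. Patching the failing calls by a perfect oracle
and using the same seed shows that the ideal probability of an event lies between the success
probability and that plus the failure probability (`OracleEquivalent.law_bounds`). And since all the
many runs on a block must succeed, a block with failure probability above `δ` rarely passes; for the
others, conditioning on passing distorts hit probabilities only mildly. `prodExpect_eventProb_le`
combines these for fixed `σ`; `PRSMA.mechanism_privacy` averages over `σ`. -/

section

/-! ### Exponential moments for uniformly random permutations. -/

open Real Finset

/-- Hoeffding's lemma for the uniform distribution: the values lie in an interval of length `c`
starting at the minimum. -/
theorem sum_exp_le_of_abs_sub_le {p : Type*} [Fintype p] [Nonempty p] (h : p → ℝ) {c : ℝ}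
    (hc : ∀ i j, |h i - h j| ≤ c) (l : ℝ) :
    ∑ i, exp (l * h i) ≤
      Fintype.card p * exp (l * ((∑ i, h i) / Fintype.card p) + l ^ 2 * c ^ 2 / 8) := by
  classical
  let _ : MeasurableSpace p := ⊤
  set μ := (PMF.uniformOfFintype p).toMeasure with hμ
  have hint : ∀ f : p → ℝ, ∫ x, f x ∂μ = (∑ i, f i) / Fintype.card p := by
    intro f
    rw [hμ, PMF.integral_eq_sum]
    simp [PMF.uniformOfFintype_apply, ← Finset.mul_sum, div_eq_inv_mul]
  obtain ⟨i₀, -, hi₀⟩ := Finset.exists_min_image Finset.univ h Finset.univ_nonempty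
  have hsub := ProbabilityTheory.hasSubgaussianMGF_of_mem_Icc (μ := μ) (X := h) (a := h i₀)
    (b := h i₀ + c) (Measurable.of_discrete.aemeasurable) (Filter.Eventually.of_forall fun i => by
      have := abs_le.1 (hc i i₀)
      exact ⟨hi₀ i (Finset.mem_univ _), by linarith [this.2]⟩)
  have hm := hsub.mgf_le l
  have hcard : (0 : ℝ) < Fintype.card p := by exact_mod_cast Fintype.card_pos
  rw [ProbabilityTheory.mgf, hint, hint, div_le_iff₀ hcard] at hm
  have h1 : ∑ i, exp (l * h i) =
      exp (l * ((∑ i, h i) / Fintype.card p)) *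
        ∑ i, exp (l * (h i - (∑ i, h i) / Fintype.card p)) := by
    rw [Finset.mul_sum]
    refine Finset.sum_congr rfl fun i _ => ?_
    rw [← exp_add]; ring_nf
  rw [h1, exp_add]
  have h2 : exp ((((‖h i₀ + c - h i₀‖₊ / 2) ^ 2 : NNReal) : ℝ) * l ^ 2 / 2) =
      exp (l ^ 2 * c ^ 2 / 8) := by
    congr 1
    rw [NNReal.coe_pow, NNReal.coe_div, add_sub_cancel_left, coe_nnnorm, Real.norm_eq_abs, div_pow,
      sq_abs]
    norm_num
    ring
  rw [h2] at hm
  calc _ ≤ exp (l * ((∑ i, h i) / Fintype.card p)) * (exp (l ^ 2 * c ^ 2 / 8) * Fintype.card p) := by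
        gcongr
    _ = _ := by ring

theorem abs_sum_div_sub_sum_div_le {p : Type*} [Fintype p] [Nonempty p] {f g : p → ℝ} {c : ℝ}
    (h : ∀ i, |f i - g i| ≤ c) :
    |(∑ i, f i) / Fintype.card p - (∑ i, g i) / Fintype.card p| ≤ c := by
  have hcard : (0 : ℝ) < Fintype.card p := by exact_mod_cast Fintype.card_pos
  rw [← sub_div, ← Finset.sum_sub_distrib, abs_div, abs_of_pos hcard, div_le_iff₀ hcard]
  calc _ ≤ ∑ i, |f i - g i| := Finset.abs_sum_le_sum_abs _ _
    _ ≤ ∑ _i : p, c := Finset.sum_le_sum fun i _ => h i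
    _ = _ := by simp [mul_comm]

/-- Martingale argument as an induction: reveal `σ 0 = p` and apply the hypothesis to the
permutation `e` of the rest. Coupling two values of `p` through the same `e` alters at most three
entries, so the conditional means vary by at most `3 * c`, and Hoeffding's lemma handles the
revealed entry. -/
theorem sum_perm_exp_le (m : ℕ) : ∀ (n : ℕ) (f : Equiv.Perm (Fin n) → ℝ) {c : ℝ}, 0 ≤ c →
    (∀ σ τ, |f σ - f τ| ≤ c * #{j : Fin n | (j : ℕ) < m ∧ σ j ≠ τ j}) → ∀ l : ℝ,
    ∑ σ, exp (l * f σ) ≤ Fintype.card (Equiv.Perm (Fin n)) *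
      exp (l * ((∑ σ, f σ) / Fintype.card (Equiv.Perm (Fin n))) +
        m * (l ^ 2 * (3 * c) ^ 2 / 8)) := by
  induction m with
  | zero =>
    intro n f c hc hf l
    have := sum_exp_le_of_abs_sub_le f (c := 0) (fun i j => by simpa using hf i j) l
    simpa using this
  | succ m ih =>
    intro n f c hc hf l
    cases n with
    | zero =>
      have := sum_exp_le_of_abs_sub_le f (c := 0) (fun i j => by simpa using hf i j) l
      refine this.trans ?_
      gcongr
      have : 0 ≤ l ^ 2 * (3 * c) ^ 2 / 8 := by positivity
      simp only [ne_eq, OfNat.ofNat_ne_zero, not_false_eq_true, zero_pow, mul_zero, zero_div]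
      positivity
    | succ n =>
      set N : ℝ := (Fintype.card (Equiv.Perm (Fin n)) : ℝ) with hN
      have hNpos : 0 < N := by rw [hN]; exact_mod_cast Fintype.card_pos
      set g : Fin (n + 1) → Equiv.Perm (Fin n) → ℝ :=
        fun p e => f (Equiv.Perm.decomposeFin.symm (p, e)) with hg
      have hsplit : ∀ F : Equiv.Perm (Fin (n + 1)) → ℝ,
          ∑ σ, F σ = ∑ p, ∑ e, F (Equiv.Perm.decomposeFin.symm (p, e)) := by
        intro F
        rw [← Equiv.sum_comp Equiv.Perm.decomposeFin.symm, Fintype.sum_prod_type]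
      have hcard : (Fintype.card (Equiv.Perm (Fin (n + 1))) : ℝ) = (n + 1) * N := by
        rw [hN, Fintype.card_perm, Fintype.card_perm, Fintype.card_fin, Fintype.card_fin,
          Nat.factorial_succ]
        push_cast; ring
      have h1 : ∀ p, ∑ e, exp (l * g p e) ≤ N * exp (l * ((∑ e, g p e) / N) +
          m * (l ^ 2 * (3 * c) ^ 2 / 8)) := by
        intro p
        refine ih n (g p) hc (fun e e' => (hf _ _).trans ?_) l
        gcongr
        rw [← Finset.card_map (Fin.succEmb n)]
        refine Finset.card_le_card fun j hj => ?_
        obtain ⟨hjm, hj⟩ := (Finset.mem_filter.1 hj).2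
        induction j using Fin.cases with
        | zero => simp at hj
        | succ k =>
          rw [Equiv.Perm.decomposeFin_symm_apply_succ, Equiv.Perm.decomposeFin_symm_apply_succ] at hj
          refine Finset.mem_map_of_mem (Fin.succEmb n) (Finset.mem_filter.2 ⟨Finset.mem_univ _, ?_, ?_⟩)
          · simpa using hjm
          · rintro h
            exact hj (by rw [h])
      have h2 : ∀ p p', |(∑ e, g p e) / N - (∑ e, g p' e) / N| ≤ 3 * c := by
        intro p p'
        refine abs_sum_div_sub_sum_div_le fun e => (hf _ _).trans ?_
        rw [mul_comm]
        gcongr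
        -- The permutation coded by `(p, e)` is `τ` followed by `swap 0 p`. Hence those for `p` and
        -- `p'` can differ only at `0` and where `τ` takes the value `p` or `p'`.
        set τ := Equiv.Perm.decomposeFin.symm ((0 : Fin (n + 1)), e) with hτ
        have hle := Finset.card_le_three (a := (0 : Fin (n + 1))) (b := τ.symm p) (c := τ.symm p')
        refine le_trans ?_ (by exact_mod_cast hle : (#{0, τ.symm p, τ.symm p'} : ℝ) ≤ 3)
        norm_cast
        refine Finset.card_le_card fun j hj => ?_
        obtain ⟨-, hj⟩ := (Finset.mem_filter.1 hj).2
        induction j using Fin.cases with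
        | zero => simp
        | succ k =>
          have hk : τ k.succ = (e k).succ := by
            rw [hτ, Equiv.Perm.decomposeFin_symm_apply_succ, Equiv.swap_self, Equiv.refl_apply]
          rw [Equiv.Perm.decomposeFin_symm_apply_succ, Equiv.Perm.decomposeFin_symm_apply_succ] at hj
          simp only [Finset.mem_insert, Finset.mem_singleton, Equiv.eq_symm_apply, hk]
          by_contra! hne
          rw [Equiv.swap_apply_of_ne_of_ne (Fin.succ_ne_zero _) hne.2.1,
            Equiv.swap_apply_of_ne_of_ne (Fin.succ_ne_zero _) hne.2.2] at hj
          exact hj rfl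
      have h3 := sum_exp_le_of_abs_sub_le (fun p => (∑ e, g p e) / N) h2 l
      rw [hsplit, hsplit, hcard]
      calc ∑ p, ∑ e, exp (l * g p e)
          ≤ ∑ p, N * exp (l * ((∑ e, g p e) / N) + m * (l ^ 2 * (3 * c) ^ 2 / 8)) :=
            Finset.sum_le_sum fun p _ => h1 p
        _ = N * exp (m * (l ^ 2 * (3 * c) ^ 2 / 8)) * ∑ p, exp (l * ((∑ e, g p e) / N)) := by
            rw [Finset.mul_sum]
            refine Finset.sum_congr rfl fun p _ => ?_
            rw [exp_add]; ring
        _ ≤ N * exp (m * (l ^ 2 * (3 * c) ^ 2 / 8)) * ((n + 1) * exp (l * ((∑ p, ∑ e, g p e) /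
              ((n + 1) * N)) + l ^ 2 * (3 * c) ^ 2 / 8)) := by
            rw [Fintype.card_fin, ← Finset.sum_div, div_div, mul_comm N] at h3
            push_cast at h3
            gcongr
        _ = _ := by
            rw [show ((m + 1 : ℕ) : ℝ) * (l ^ 2 * (3 * c) ^ 2 / 8) = m * (l ^ 2 * (3 * c) ^ 2 / 8) +
              l ^ 2 * (3 * c) ^ 2 / 8 by push_cast; ring, exp_add, exp_add, exp_add]
            ring

/-- A bounded-differences inequality for `m` consecutive entries of a uniformly random permutation. -/
theorem sum_perm_exp_comp_le {n m a : ℕ} (ham : a + m ≤ n) (F : (Fin m → Fin n) → ℝ) {c : ℝ}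
    (hc : 0 ≤ c) (hF : ∀ g g' : Fin m → Fin n, ∀ j, (∀ k, k ≠ j → g k = g' k) → |F g - F g'| ≤ c)
    (l : ℝ) :
    ∑ σ : Equiv.Perm (Fin n), exp (l * F fun j => σ ⟨a + j, by omega⟩) ≤
      Fintype.card (Equiv.Perm (Fin n)) *
      exp (l * ((∑ σ : Equiv.Perm (Fin n), F fun j => σ ⟨j, by omega⟩) /
          Fintype.card (Equiv.Perm (Fin n))) +
        m * (l ^ 2 * (3 * c) ^ 2 / 8)) := by
  have hdiff : ∀ (s : Finset (Fin m)) (g g' : Fin m → Fin n), (∀ k, k ∉ s → g k = g' k) →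
      |F g - F g'| ≤ c * #s := by
    intro s
    induction s using Finset.induction_on with
    | empty =>
      intro g g' h
      rw [show g = g' from funext fun k => h k (by simp)]
      simp
    | insert i s hi ih =>
      intro g g' h
      have h1 := hF g (Function.update g i (g' i)) i fun k hk => by
        rw [Function.update_of_ne hk]
      have h2 := ih (Function.update g i (g' i)) g' fun k hk => by
        by_cases hki : k = i
        · subst hki; simp
        · rw [Function.update_of_ne hki]
          exact h k (by simp [hki, hk])
      rw [Finset.card_insert_of_notMem hi]
      push_cast
      calc _ ≤ _ := abs_sub_le _ (F (Function.update g i (g' i))) _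
        _ ≤ c + c * #s := add_le_add h1 h2
        _ = _ := by ring
  have hmain := sum_perm_exp_le m n (fun σ => F fun j => σ ⟨j, by omega⟩) hc (fun σ τ => by
    refine (hdiff {j : Fin m | σ ⟨j, by omega⟩ ≠ τ ⟨j, by omega⟩} _ _ fun k hk => by
      simpa using hk).trans ?_
    gcongr
    refine Finset.card_le_card_of_injOn (fun j : Fin m => (⟨j, by omega⟩ : Fin n)) ?_ ?_
    · intro j hj
      simp only [Finset.coe_filter, Finset.mem_univ, true_and, Set.mem_ofPred_eq] at hj ⊢
      exact ⟨j.2, hj⟩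
    · intro j _ j' _ h
      simpa [Fin.ext_iff] using h) l
  rcases Nat.eq_zero_or_pos m with rfl | hm
  · refine le_trans (le_of_eq ?_) hmain
    refine Finset.sum_congr rfl fun σ _ => ?_
    congr 3
    exact funext fun j => j.elim0
  · have : NeZero n := ⟨by omega⟩
    refine le_trans (le_of_eq ?_) hmain
    -- Precomposition with the cyclic shift by `a` is a bijection of the permutations and moves the
    -- window to the start. So all windows share one centre, that of the initial window.
    rw [← Equiv.sum_comp (Equiv.mulRight (Equiv.addRight (Fin.ofNat n a)))
      (fun σ : Equiv.Perm (Fin n) => exp (l * F fun j => σ ⟨j, by omega⟩))]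
    refine Finset.sum_congr rfl fun σ _ => ?_
    congr 3
    funext j
    simp only [Equiv.coe_mulRight, Equiv.Perm.coe_mul, Function.comp_apply, Equiv.coe_addRight]
    congr 1
    ext
    have := j.2
    simp [Fin.val_add, Nat.add_comm a, Nat.mod_eq_of_lt (show (j : ℕ) + a < n by omega)]

end

/-! ### A reference measure for the base algorithm on random blocks. -/

noncomputable section

/-- The densities are positive and obey the ratio bound at every point, so their logarithms can be
treated pointwise. On the exceptional null set all of them are set to `1`, whence `max c 0`. -/
theorem exists_density {ι M : Type*} [Finite ι] [Nonempty ι] [MeasurableSpace M]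
    (μ : ι → Measure M) [∀ i, IsProbabilityMeasure (μ i)] (hac : ∀ i j, μ i ≪ μ j)
    (r : ι → ι → Prop) (c : ℝ)
    (hr : ∀ i j, r i j → ∀ E, MeasurableSet E → μ i E ≤ ENNReal.ofReal (Real.exp c) * μ j E) :
    ∃ (μ₀ : Measure M) (ρ : ι → M → ℝ), (∀ i, Measurable (ρ i)) ∧ (∀ i x, 0 < ρ i x) ∧
      (∀ i j, r i j → ∀ x, ρ i x ≤ Real.exp (max c 0) * ρ j x) ∧
      ∀ i E, MeasurableSet E → μ i E = ∫⁻ x in E, ENNReal.ofReal (ρ i x) ∂μ₀ := by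
  classical
  obtain ⟨i₀⟩ := ‹Nonempty ι›
  set ψ : ι → M → ℝ≥0∞ := fun i => (μ i).rnDeriv (μ i₀) with hψ
  have hψm : ∀ i, Measurable (ψ i) := fun i => Measure.measurable_rnDeriv _ _
  set good : Set M := {x | (∀ i, 0 < ψ i x ∧ ψ i x < ∞) ∧
    ∀ i j, r i j → ψ i x ≤ ENNReal.ofReal (Real.exp c) * ψ j x} with hgood
  have hgm : MeasurableSet good := by
    refine MeasurableSet.inter (s₁ := {x | ∀ i, 0 < ψ i x ∧ ψ i x < ∞})
      (s₂ := {x | ∀ i j, r i j → ψ i x ≤ ENNReal.ofReal (Real.exp c) * ψ j x}) ?_ ?_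
    · rw [Set.ofPred_forall]
      exact MeasurableSet.iInter fun i =>
        (measurableSet_lt measurable_const (hψm i)).inter (measurableSet_lt (hψm i) measurable_const)
    · rw [Set.ofPred_forall]
      refine MeasurableSet.iInter fun i => ?_
      rw [Set.ofPred_forall]
      refine MeasurableSet.iInter fun j => ?_
      by_cases h : r i j
      · simp only [h, forall_const]
        exact measurableSet_le (hψm i) ((hψm j).const_mul _)
      · simp [h]
  have hae : ∀ᵐ x ∂(μ i₀), x ∈ good := by
    have h1 : ∀ᵐ x ∂(μ i₀), ∀ i, 0 < ψ i x ∧ ψ i x < ∞ := by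
      rw [ae_all_iff]
      intro i
      filter_upwards [Measure.rnDeriv_pos' (hac i₀ i), Measure.rnDeriv_lt_top (μ i) (μ i₀)]
        with x hx hx' using ⟨hx, hx'⟩
    have h2 : ∀ᵐ x ∂(μ i₀), ∀ i j, r i j → ψ i x ≤ ENNReal.ofReal (Real.exp c) * ψ j x := by
      rw [ae_all_iff]
      intro i
      rw [ae_all_iff]
      intro j
      by_cases h : r i j
      · simp only [h, forall_const]
        refine ae_le_of_forall_setLIntegral_le_of_sigmaFinite (hψm i) fun s hs _ => ?_
        rw [lintegral_const_mul _ (hψm j), Measure.setLIntegral_rnDeriv (hac i i₀),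
          Measure.setLIntegral_rnDeriv (hac j i₀)]
        exact hr i j h s hs
      · simp [h]
    filter_upwards [h1, h2] with x hx hx' using ⟨hx, hx'⟩
  refine ⟨μ i₀, fun i x => if x ∈ good then (ψ i x).toReal else 1, fun i => ?_, fun i x => ?_,
    fun i j h x => ?_, fun i E hE => ?_⟩
  · exact Measurable.ite hgm (hψm i).ennreal_toReal measurable_const
  · dsimp only
    split_ifs with hx
    · exact ENNReal.toReal_pos (hx.1 i).1.ne' (hx.1 i).2.ne
    · exact one_pos
  · dsimp only
    split_ifs with hx
    · have := ENNReal.toReal_mono (ENNReal.mul_ne_top ENNReal.ofReal_ne_top (hx.1 j).2.ne)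
        (hx.2 i j h)
      rw [ENNReal.toReal_mul, ENNReal.toReal_ofReal (Real.exp_pos _).le] at this
      refine this.trans ?_
      gcongr
      exact le_max_left _ _
    · rw [mul_one]
      exact Real.one_le_exp (le_max_right _ _)
  · rw [← Measure.setLIntegral_rnDeriv (hac i i₀)]
    refine lintegral_congr_ae (ae_restrict_of_ae ?_)
    filter_upwards [hae] with x hx
    simp only [hx, if_true]
    rw [ENNReal.ofReal_toReal (hx.1 i).2.ne]

theorem absolutelyContinuous_of_adjacent {κ β M : Type*} [Finite κ] [MeasurableSpace M]
    (μ : (κ → β) → Measure M) {c : ℝ}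
    (hDP : ∀ (g g' : κ → β) (j : κ), (∀ k, k ≠ j → g k = g' k) → ∀ E, MeasurableSet E →
      μ g E ≤ ENNReal.ofReal (Real.exp c) * μ g' E) (g g' : κ → β) : μ g ≪ μ g' := by
  classical
  have key : ∀ (s : Finset κ) (g g' : κ → β), (∀ k, k ∉ s → g k = g' k) → μ g ≪ μ g' := by
    intro s
    induction s using Finset.induction_on with
    | empty =>
      intro g g' h
      rw [show g = g' from funext fun k => h k (by simp)]
    | insert i s hi ih =>
      intro g g' h
      refine Measure.AbsolutelyContinuous.trans (μ₂ := μ (Function.update g i (g' i))) ?_ ?_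
      · refine Measure.AbsolutelyContinuous.mk fun E hE h0 => ?_
        have := hDP g (Function.update g i (g' i)) i
          (fun k hk => by rw [Function.update_of_ne hk]) E hE
        rw [h0, mul_zero] at this
        exact le_antisymm this zero_le
      · refine ih _ _ fun k hk => ?_
        by_cases hki : k = i
        · subst hki; simp
        · rw [Function.update_of_ne hki]
          exact h k (by simp [hki, hk])
  cases nonempty_fintype κ
  exact key Finset.univ g g' (by simp)

/-- A Chernoff bound in pointwise form: either `x - y ≤ t`, or the last exponent is at least `x -
y`. It is used with `x` a log-density and `y` its mean; the primed version treats deviations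
downwards. -/
theorem exp_le_exp_mul_add (x y t : ℝ) {l : ℝ} (hl : 1 ≤ l) :
    Real.exp x ≤ Real.exp t * Real.exp y +
      Real.exp y * Real.exp (l * (x - y) - (l - 1) * t) := by
  rw [← Real.exp_add, ← Real.exp_add]
  by_cases h : x - y ≤ t
  · have : Real.exp x ≤ Real.exp (t + y) := Real.exp_le_exp.2 (by linarith)
    linarith [Real.exp_pos (y + (l * (x - y) - (l - 1) * t))]
  · have : Real.exp x ≤ Real.exp (y + (l * (x - y) - (l - 1) * t)) :=
      Real.exp_le_exp.2 (by nlinarith)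
    linarith [Real.exp_pos (t + y)]

theorem exp_le_exp_mul_add' (x y t : ℝ) {l : ℝ} (hl : 0 ≤ l) :
    Real.exp y ≤ Real.exp t * Real.exp x +
      Real.exp y * Real.exp (-l * (x - y) - l * t) := by
  rw [← Real.exp_add, ← Real.exp_add]
  by_cases h : y - x ≤ t
  · have : Real.exp y ≤ Real.exp (t + x) := Real.exp_le_exp.2 (by linarith)
    linarith [Real.exp_pos (y + (-l * (x - y) - l * t))]
  · have : Real.exp y ≤ Real.exp (y + (-l * (x - y) - l * t)) :=
      Real.exp_le_exp.2 (by nlinarith)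
    linarith [Real.exp_pos (t + x)]

/-- The output distributions of a pure differentially private algorithm on random subsamples are
close to a reference measure of `E`, up to additive errors that are small on average. -/
theorem exists_reference {M : Type*} [MeasurableSpace M] {n m : ℕ} (hmn : m ≤ n) (hn : 0 < n)
    (μ : (Fin m → Fin n) → Measure M) [∀ g, IsProbabilityMeasure (μ g)] {c : ℝ} (hc : 0 ≤ c)
    (hDP : ∀ (g g' : Fin m → Fin n) (j : Fin m), (∀ k, k ≠ j → g k = g' k) →
      ∀ E, MeasurableSet E → μ g E ≤ ENNReal.ofReal (Real.exp c) * μ g' E)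
    {l t : ℝ} (hl : 1 ≤ l) {E : Set M} (hE : MeasurableSet E) :
    ∃ (q : ℝ≥0∞) (U D : (Fin m → Fin n) → ℝ≥0∞), q ≤ 1 ∧
      (∀ g, μ g E ≤ ENNReal.ofReal (Real.exp t) * q + U g) ∧
      (∀ g, q ≤ ENNReal.ofReal (Real.exp t) * μ g E + D g) ∧
      ∀ a (ha : a + m ≤ n),
        ∑ σ : Equiv.Perm (Fin n), U (fun j => σ ⟨a + j, by omega⟩) ≤
          ENNReal.ofReal (Fintype.card (Equiv.Perm (Fin n)) *
            Real.exp (m * (l ^ 2 * (3 * c) ^ 2 / 8) - (l - 1) * t)) ∧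
        ∑ σ : Equiv.Perm (Fin n), D (fun j => σ ⟨a + j, by omega⟩) ≤
          ENNReal.ofReal (Fintype.card (Equiv.Perm (Fin n)) *
            Real.exp (m * (l ^ 2 * (3 * c) ^ 2 / 8) - l * t)) := by
  classical
  have : Nonempty (Fin n) := ⟨⟨0, hn⟩⟩
  obtain ⟨μ₀, ρ, hρm, hρpos, hρr, hρ⟩ := exists_density μ (absolutelyContinuous_of_adjacent μ hDP)
    (fun g g' => ∃ j, ∀ k, k ≠ j → g k = g' k) c (fun g g' ⟨j, hj⟩ => hDP g g' j hj)
  rw [max_eq_left hc] at hρr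
  set N : ℝ := (Fintype.card (Equiv.Perm (Fin n)) : ℝ) with hN
  have hNpos : 0 < N := by rw [hN]; exact_mod_cast Fintype.card_pos
  set F : M → (Fin m → Fin n) → ℝ := fun x g => Real.log (ρ g x) with hF
  have hexpF : ∀ x g, Real.exp (F x g) = ρ g x := fun x g => Real.exp_log (hρpos g x)
  have hFm : ∀ g, Measurable fun x => F x g := fun g => (hρm g).log
  have hFc : ∀ x, ∀ g g' : Fin m → Fin n, ∀ j, (∀ k, k ≠ j → g k = g' k) →
      |F x g - F x g'| ≤ c := by
    have h1 : ∀ x, ∀ g g' : Fin m → Fin n, ∀ j, (∀ k, k ≠ j → g k = g' k) →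
        F x g - F x g' ≤ c := by
      intro x g g' j h
      have := Real.log_le_log (hρpos g x) (hρr g g' ⟨j, h⟩ x)
      rw [Real.log_mul (Real.exp_pos _).ne' (hρpos _ _).ne', Real.log_exp] at this
      simp only [hF]
      linarith
    intro x g g' j h
    have h2 := h1 x g g' j h
    have h3 := h1 x g' g j fun k hk => (h k hk).symm
    exact abs_le.2 ⟨by linarith, h2⟩
  -- `exp (A x)` is the geometric mean of the densities over all arrangements.
  set A : M → ℝ := fun x => (∑ σ : Equiv.Perm (Fin n), F x fun j => σ ⟨j, by omega⟩) / N with hA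
  have hAm : Measurable A := (Finset.measurable_sum _ fun σ _ => hFm _).div_const _
  have hmgf : ∀ x (l : ℝ) a (ha : a + m ≤ n),
      ∑ σ : Equiv.Perm (Fin n), Real.exp (l * (F x (fun j => σ ⟨a + j, by omega⟩) - A x)) ≤
        N * Real.exp (m * (l ^ 2 * (3 * c) ^ 2 / 8)) := by
    intro x l a ha
    have h := sum_perm_exp_comp_le ha (F x) hc (hFc x) l
    calc _ = Real.exp (-(l * A x)) *
          ∑ σ : Equiv.Perm (Fin n), Real.exp (l * F x (fun j => σ ⟨a + j, by omega⟩)) := by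
          rw [Finset.mul_sum]
          refine Finset.sum_congr rfl fun σ _ => ?_
          rw [← Real.exp_add]; ring_nf
      _ ≤ Real.exp (-(l * A x)) *
          (N * Real.exp (l * A x + m * (l ^ 2 * (3 * c) ^ 2 / 8))) := by gcongr
      _ = _ := by
          rw [mul_left_comm, ← Real.exp_add, neg_add_cancel_left]
  -- The geometric mean is at most the arithmetic mean, a probability density; here this follows
  -- from `u + 1 ≤ exp u`.
  have hq1 : ∫⁻ x, ENNReal.ofReal (Real.exp (A x)) ∂μ₀ ≤ 1 := by
    have hjensen : ∀ x, Real.exp (A x) ≤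
        N⁻¹ * ∑ σ : Equiv.Perm (Fin n), ρ (fun j => σ ⟨j, by omega⟩) x := by
      intro x
      have h1 : N ≤ ∑ σ : Equiv.Perm (Fin n),
          Real.exp (F x (fun j => σ ⟨j, by omega⟩) - A x) := by
        calc N = ∑ σ : Equiv.Perm (Fin n), (F x (fun j => σ ⟨j, by omega⟩) - A x + 1) := by
              rw [Finset.sum_add_distrib, Finset.sum_sub_distrib]
              simp only [hA, Finset.sum_const, Finset.card_univ, nsmul_eq_mul, ← hN]
              field_simp
              ring
          _ ≤ _ := Finset.sum_le_sum fun σ _ => Real.add_one_le_exp _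
      rw [inv_mul_eq_div, le_div_iff₀ hNpos]
      calc _ ≤ Real.exp (A x) * ∑ σ : Equiv.Perm (Fin n),
          Real.exp (F x (fun j => σ ⟨j, by omega⟩) - A x) := by gcongr
        _ = _ := by
          rw [Finset.mul_sum]
          refine Finset.sum_congr rfl fun σ _ => ?_
          rw [← Real.exp_add, add_sub_cancel, hexpF]
    calc _ ≤ ∫⁻ x, ENNReal.ofReal N⁻¹ * ∑ σ : Equiv.Perm (Fin n),
          ENNReal.ofReal (ρ (fun j => σ ⟨j, by omega⟩) x) ∂μ₀ := by
          refine lintegral_mono fun x => ?_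
          rw [← ENNReal.ofReal_sum_of_nonneg fun σ _ => (hρpos _ x).le,
            ← ENNReal.ofReal_mul (by positivity)]
          exact ENNReal.ofReal_le_ofReal (hjensen x)
      _ = ENNReal.ofReal N⁻¹ * ∑ σ : Equiv.Perm (Fin n), 1 := by
          rw [lintegral_const_mul _ (Finset.measurable_sum _ fun σ _ => (hρm _).ennreal_ofReal),
            lintegral_finsetSum _ fun σ _ => (hρm _).ennreal_ofReal]
          congr 1
          refine Finset.sum_congr rfl fun σ _ => ?_
          rw [← setLIntegral_univ, ← hρ _ _ MeasurableSet.univ, measure_univ]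
      _ = 1 := by
          rw [Finset.sum_const, Finset.card_univ, nsmul_eq_mul, mul_one,
            ← ENNReal.ofReal_natCast, ← ENNReal.ofReal_mul (by positivity), ← hN,
            inv_mul_cancel₀ hNpos.ne', ENNReal.ofReal_one]
  -- Integrate the pointwise moment bound against the reference density. The case `l' = l` controls
  -- upward deviations, `l' = -l` downward ones.
  have hsum : ∀ (l' s : ℝ) a (ha : a + m ≤ n),
      ∑ σ : Equiv.Perm (Fin n), ∫⁻ x, ENNReal.ofReal (Real.exp (A x) *
        Real.exp (l' * (F x (fun j => σ ⟨a + j, by omega⟩) - A x) - s)) ∂μ₀ ≤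
      ENNReal.ofReal (N * Real.exp (m * (l' ^ 2 * (3 * c) ^ 2 / 8) - s)) := by
    intro l' s a ha
    rw [← lintegral_finsetSum _ fun σ _ => by fun_prop]
    calc _ ≤ ∫⁻ x, ENNReal.ofReal (N * Real.exp (m * (l' ^ 2 * (3 * c) ^ 2 / 8) - s)) *
          ENNReal.ofReal (Real.exp (A x)) ∂μ₀ := by
          refine lintegral_mono fun x => ?_
          rw [← ENNReal.ofReal_sum_of_nonneg fun σ _ => by positivity,
            ← ENNReal.ofReal_mul (by positivity)]
          refine ENNReal.ofReal_le_ofReal ?_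
          have h := hmgf x l' a ha
          generalize m * (l' ^ 2 * (3 * c) ^ 2 / 8) = V at h ⊢
          simp_rw [Real.exp_sub _ s, mul_div_assoc']
          rw [← Finset.sum_div, div_mul_eq_mul_div, ← Finset.mul_sum]
          refine div_le_div_of_nonneg_right ?_ (Real.exp_pos _).le
          rw [mul_comm]
          exact mul_le_mul_of_nonneg_right h (Real.exp_pos _).le
      _ = ENNReal.ofReal (N * Real.exp (m * (l' ^ 2 * (3 * c) ^ 2 / 8) - s)) *
          ∫⁻ x, ENNReal.ofReal (Real.exp (A x)) ∂μ₀ :=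
          lintegral_const_mul _ (by fun_prop)
      _ ≤ _ := mul_le_of_le_one_right' hq1
  refine ⟨∫⁻ x in E, ENNReal.ofReal (Real.exp (A x)) ∂μ₀,
    fun g => ∫⁻ x, ENNReal.ofReal (Real.exp (A x) *
      Real.exp (l * (F x g - A x) - (l - 1) * t)) ∂μ₀,
    fun g => ∫⁻ x, ENNReal.ofReal (Real.exp (A x) *
      Real.exp (-l * (F x g - A x) - l * t)) ∂μ₀, (setLIntegral_le_lintegral _ _).trans hq1,
    fun g => ?_, fun g => ?_, fun a ha => ⟨hsum l _ a ha, ?_⟩⟩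
  · rw [hρ g E hE, ← lintegral_const_mul _ (by fun_prop)]
    refine le_trans ?_ (add_le_add_right (setLIntegral_le_lintegral E _) _)
    rw [← lintegral_add_left (by fun_prop)]
    refine lintegral_mono fun x => ?_
    rw [← ENNReal.ofReal_mul (Real.exp_pos _).le,
      ← ENNReal.ofReal_add (by positivity) (by positivity), ← hexpF]
    exact ENNReal.ofReal_le_ofReal (exp_le_exp_mul_add _ _ _ hl)
  · rw [hρ g E hE, ← lintegral_const_mul _ (hρm g).ennreal_ofReal]
    refine le_trans ?_ (add_le_add_right (setLIntegral_le_lintegral E _) _)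
    rw [← lintegral_add_left ((hρm g).ennreal_ofReal.const_mul _)]
    refine lintegral_mono fun x => ?_
    rw [← ENNReal.ofReal_mul (Real.exp_pos _).le,
      ← ENNReal.ofReal_add (by have := hρpos g x; positivity) (by positivity), ← hexpF]
    exact ENNReal.ofReal_le_ofReal (exp_le_exp_mul_add' _ _ _ (by linarith))
  · simpa using hsum (-l) (l * t) a ha

end

/-! ### Laplace noise and the release threshold. -/

noncomputable section

theorem laplaceMeasure_Ioi {b x : ℝ} (hb : 0 < b) (hx : 0 ≤ x) :
    laplaceMeasure b (Set.Ioi x) = ENNReal.ofReal (Real.exp (-x / b) / 2) := by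
  have ha : -b⁻¹ < 0 := by simpa using hb
  rw [laplaceMeasure, withDensity_apply _ measurableSet_Ioi,
    setLIntegral_congr_fun (g := fun z => ENNReal.ofReal (1 / (2 * b) * Real.exp (-b⁻¹ * z)))
      measurableSet_Ioi, ← ofReal_integral_eq_lintegral_ofReal, integral_const_mul,
    integral_exp_mul_Ioi ha]
  · congr 1
    rw [show -b⁻¹ * x = -x / b by field_simp]
    field_simp
  · exact (integrableOn_exp_mul_Ioi ha x).const_mul _
  · exact Filter.Eventually.of_forall fun z => by positivity
  · intro z hz
    have : 0 ≤ z := hx.trans (le_of_lt hz)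
    simp only [abs_of_nonneg this]
    congr 3
    field_simp

theorem laplaceMeasure_Iic_zero {b : ℝ} (hb : 0 < b) :
    laplaceMeasure b (Set.Iic 0) = ENNReal.ofReal (1 / 2) := by
  have ha : 0 < b⁻¹ := by simpa using hb
  rw [laplaceMeasure, withDensity_apply _ measurableSet_Iic,
    setLIntegral_congr_fun (g := fun z => ENNReal.ofReal (1 / (2 * b) * Real.exp (b⁻¹ * z)))
      measurableSet_Iic, ← ofReal_integral_eq_lintegral_ofReal, integral_const_mul,
    integral_exp_mul_Iic ha]
  · congr 1
    rw [mul_zero, Real.exp_zero]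
    field_simp
  · exact (integrableOn_exp_mul_Iic ha 0).const_mul _
  · exact Filter.Eventually.of_forall fun z => by positivity
  · intro z hz
    have : z ≤ 0 := hz
    simp only [abs_of_nonpos this]
    congr 3
    field_simp

theorem isProbabilityMeasure_laplaceMeasure {b : ℝ} (hb : 0 < b) :
    IsProbabilityMeasure (laplaceMeasure b) := by
  constructor
  rw [← Set.Iic_union_Ioi (a := (0 : ℝ)), measure_union (Set.Iic_disjoint_Ioi le_rfl) measurableSet_Ioi,
    laplaceMeasure_Iic_zero hb, laplaceMeasure_Ioi hb le_rfl,
    ← ENNReal.ofReal_add (by positivity) (by positivity), neg_zero, zero_div, Real.exp_zero,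
    add_halves, ENNReal.ofReal_one]

/-- The Laplace density changes by a factor of at most `exp (|s| / b)` under translation by `s`. -/
theorem laplaceMeasure_preimage_add_le {b : ℝ} (hb : 0 < b) (s : ℝ) {A : Set ℝ}
    (hA : MeasurableSet A) :
    laplaceMeasure b ((fun z => z + s) ⁻¹' A) ≤
      ENNReal.ofReal (Real.exp (|s| / b)) * laplaceMeasure b A := by
  set p : ℝ → ℝ≥0∞ := fun z => ENNReal.ofReal (1 / (2 * b) * Real.exp (-|z| / b)) with hp
  have hpm : Measurable p := by fun_prop
  have h1 : laplaceMeasure b ((fun z => z + s) ⁻¹' A) = ∫⁻ z in A, p (z - s) := by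
    rw [laplaceMeasure, withDensity_apply _ (measurable_add_const s hA),
      ← lintegral_indicator (measurable_add_const s hA), ← lintegral_indicator hA,
      ← lintegral_add_right_eq_self (fun z => A.indicator (fun z => p (z - s)) z) s]
    refine lintegral_congr fun z => ?_
    by_cases h : z + s ∈ A
    · rw [Set.indicator_of_mem h, Set.indicator_of_mem (show z ∈ (fun z => z + s) ⁻¹' A from h),
        add_sub_cancel_right]
    · rw [Set.indicator_of_notMem h,
        Set.indicator_of_notMem (show z ∉ (fun z => z + s) ⁻¹' A from h)]
  rw [h1, laplaceMeasure, withDensity_apply _ hA, ← lintegral_const_mul _ hpm]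
  refine lintegral_mono fun z => ?_
  simp only [hp]
  rw [← ENNReal.ofReal_mul (Real.exp_pos _).le]
  refine ENNReal.ofReal_le_ofReal ?_
  rw [mul_left_comm, ← Real.exp_add, ← add_div]
  gcongr
  have := abs_sub_abs_le_abs_sub z (z - s)
  rw [sub_sub_cancel] at this
  linarith

/-- The probability that `x` plus Laplace noise exceeds the threshold `τ`. -/
def exceedProb (b τ x : ℝ) : ℝ := (laplaceMeasure b).real {z | τ < x + z}

theorem measurableSet_exceed (τ x : ℝ) : MeasurableSet {z : ℝ | τ < x + z} :=
  measurableSet_lt measurable_const (by fun_prop)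

theorem exceedProb_nonneg (b τ x : ℝ) : 0 ≤ exceedProb b τ x := measureReal_nonneg

theorem exceedProb_le_one {b : ℝ} (hb : 0 < b) (τ x : ℝ) : exceedProb b τ x ≤ 1 :=
  have := isProbabilityMeasure_laplaceMeasure hb
  measureReal_le_one

theorem exceedProb_mono {b : ℝ} (hb : 0 < b) (τ : ℝ) {x y : ℝ} (h : x ≤ y) :
    exceedProb b τ x ≤ exceedProb b τ y := by
  have := isProbabilityMeasure_laplaceMeasure hb
  exact measureReal_mono fun z (hz : τ < x + z) => show τ < y + z by linarith

theorem laplaceMeasure_real_preimage_add_le {b : ℝ} (hb : 0 < b) (s : ℝ) {A : Set ℝ}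
    (hA : MeasurableSet A) :
    (laplaceMeasure b).real ((fun z => z + s) ⁻¹' A) ≤
      Real.exp (|s| / b) * (laplaceMeasure b).real A := by
  have := isProbabilityMeasure_laplaceMeasure hb
  have h := ENNReal.toReal_mono (ENNReal.mul_ne_top ENNReal.ofReal_ne_top (measure_ne_top _ _))
    (laplaceMeasure_preimage_add_le hb s hA)
  rwa [ENNReal.toReal_mul, ENNReal.toReal_ofReal (Real.exp_pos _).le] at h

theorem exceedProb_add_one_le {b : ℝ} (hb : 0 < b) (τ x : ℝ) :
    exceedProb b τ (x + 1) ≤ Real.exp (1 / b) * exceedProb b τ x := by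
  have h := laplaceMeasure_real_preimage_add_le hb 1 (measurableSet_exceed τ x)
  rw [abs_one] at h
  refine (le_of_eq ?_).trans h
  simp only [exceedProb]
  congr 1
  ext z
  simp [add_assoc, add_comm 1 z]

theorem one_sub_exceedProb_le {b : ℝ} (hb : 0 < b) (τ x : ℝ) :
    1 - exceedProb b τ x ≤ Real.exp (1 / b) * (1 - exceedProb b τ (x + 1)) := by
  have := isProbabilityMeasure_laplaceMeasure hb
  have h := laplaceMeasure_real_preimage_add_le hb (-1) (measurableSet_exceed τ (x + 1)).compl
  rw [abs_neg, abs_one, probReal_compl_eq_one_sub (measurableSet_exceed τ (x + 1))] at h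
  simp only [exceedProb]
  rw [← probReal_compl_eq_one_sub (measurableSet_exceed τ x)]
  convert h using 2
  ext z
  simp [show x + 1 + (z + -1) = x + z by ring]

/-- With at most `1 / e` passing blocks, the noise has to exceed `(1 / e) * log (1 / d)`. -/
theorem exceedProb_le_of_le {e d x : ℝ} (he : 0 < e) (hd : 0 < d) (hd1 : d ≤ 1) (hx : x ≤ 1 / e) :
    exceedProb (1 / e) (1 / e * (1 + Real.log (1 / d))) x ≤ d / 2 := by
  have hb : 0 < 1 / e := by positivity
  have hlog : 0 ≤ Real.log (1 / d) := Real.log_nonneg (by rw [le_div_iff₀ hd]; linarith)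
  refine (exceedProb_mono hb _ hx).trans (le_of_eq ?_)
  have hset : {z : ℝ | 1 / e * (1 + Real.log (1 / d)) < 1 / e + z} =
      Set.Ioi (1 / e * Real.log (1 / d)) := by
    ext z
    simp only [Set.mem_ofPred_eq, Set.mem_Ioi, mul_add, mul_one, add_lt_add_iff_left]
  rw [exceedProb, hset, measureReal_def, laplaceMeasure_Ioi hb (by positivity),
    ENNReal.toReal_ofReal (by positivity)]
  congr 1
  rw [show -(1 / e * Real.log (1 / d)) / (1 / e) = Real.log d by
    rw [one_div d, Real.log_inv]; field_simp, Real.exp_log hd]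

end

/-! ### Expectations under finite product weights. -/

noncomputable section

/-- The expectation of `F` under the product of the finitely supported weights `w i`. -/
def prodExpect {I β : Type*} [Fintype I] [DecidableEq I] [Fintype β] (w : I → β → ℝ)
    (F : (I → β) → ℝ) : ℝ :=
  ∑ b, (∏ i, w i (b i)) * F b

theorem prod_weight_eq {I β : Type*} [Fintype I] [DecidableEq I] (w : I → β → ℝ) (p : I) (b : I → β) :
    ∏ i, w i (b i) = w p (b p) * ∏ i ∈ Finset.univ.erase p, w i (b i) :=
  (Finset.mul_prod_erase _ _ (Finset.mem_univ p)).symm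

theorem prod_weight_update {I β : Type*} [Fintype I] [DecidableEq I] (w : I → β → ℝ) (p : I) (b : I → β) (y : β) :
    ∏ i, w i (Function.update b p y i) = w p y * ∏ i ∈ Finset.univ.erase p, w i (b i) := by
  rw [prod_weight_eq w p, Function.update_self]
  congr 1
  refine Finset.prod_congr rfl fun i hi => ?_
  rw [Function.update_of_ne (Finset.ne_of_mem_erase hi)]

section prodExpect

variable {I β : Type*} [Fintype I] [DecidableEq I] [Fintype β] {w : I → β → ℝ}

theorem prodExpect_mono (hw : ∀ i y, 0 ≤ w i y) {F G : (I → β) → ℝ} (h : ∀ b, F b ≤ G b) :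
    prodExpect w F ≤ prodExpect w G :=
  Finset.sum_le_sum fun b _ =>
    mul_le_mul_of_nonneg_left (h b) (Finset.prod_nonneg fun i _ => hw i _)

theorem prodExpect_add (F G : (I → β) → ℝ) :
    prodExpect w (fun b => F b + G b) = prodExpect w F + prodExpect w G := by
  simp only [prodExpect, mul_add, Finset.sum_add_distrib]

theorem prodExpect_const_mul (a : ℝ) (F : (I → β) → ℝ) :
    prodExpect w (fun b => a * F b) = a * prodExpect w F := by
  simp only [prodExpect, Finset.mul_sum, mul_left_comm]

theorem prodExpect_sum {J : Type*} (s : Finset J) (F : J → (I → β) → ℝ) :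
    prodExpect w (fun b => ∑ j ∈ s, F j b) = ∑ j ∈ s, prodExpect w (F j) := by
  simp only [prodExpect, Finset.mul_sum]
  exact Finset.sum_comm

theorem prodExpect_prod (h : I → β → ℝ) :
    prodExpect w (fun b => ∏ i, h i (b i)) = ∏ i, ∑ y, w i y * h i y := by
  rw [Finset.prod_univ_sum, Fintype.piFinset_univ]
  simp only [prodExpect, Finset.prod_mul_distrib]

theorem prodExpect_const (hw1 : ∀ i, ∑ y, w i y = 1) (a : ℝ) :
    prodExpect w (fun _ => a) = a := by
  have h := prodExpect_prod (w := w) (fun _ _ => 1)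
  simp only [Finset.prod_const_one, mul_one, hw1] at h
  have := prodExpect_const_mul (w := w) a fun _ => 1
  simpa [h] using this

theorem prodExpect_nonneg (hw : ∀ i y, 0 ≤ w i y) {F : (I → β) → ℝ} (h : ∀ b, 0 ≤ F b) :
    0 ≤ prodExpect w F :=
  Finset.sum_nonneg fun b _ => mul_nonneg (Finset.prod_nonneg fun i _ => hw i _) (h b)

theorem sum_sum_update (p : I) (H : (I → β) → β → ℝ) :
    ∑ b, ∑ y, H b y = ∑ b, ∑ y, H (Function.update b p y) (b p) := by
  rw [← Fintype.sum_prod_type', ← Fintype.sum_prod_type']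
  refine Fintype.sum_equiv ⟨fun x => (Function.update x.1 p x.2, x.1 p),
    fun x => (Function.update x.1 p x.2, x.1 p), fun x => by simp, fun x => by simp⟩ _ _ fun x => ?_
  simp

/-- Redrawing one coordinate preserves the expectation. This replaces conditioning on all the other
coordinates. -/
theorem prodExpect_resample (hw1 : ∀ i, ∑ y, w i y = 1) (p : I) (F : (I → β) → ℝ) :
    prodExpect w (fun b => ∑ y, w p y * F (Function.update b p y)) = prodExpect w F := by
  simp only [prodExpect, Finset.mul_sum]
  rw [sum_sum_update p]
  refine Finset.sum_congr rfl fun b _ => ?_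
  simp only [Function.update_idem, Function.update_eq_self, prod_weight_update]
  rw [prod_weight_eq w p b]
  calc _ = ∑ y, w p y * ((w p (b p) * ∏ i ∈ Finset.univ.erase p, w i (b i)) * F b) :=
        Finset.sum_congr rfl fun y _ => by ring
    _ = _ := by rw [← Finset.sum_mul, hw1, one_mul]

theorem prodExpect_le_of_resample (hw : ∀ i y, 0 ≤ w i y) (hw1 : ∀ i, ∑ y, w i y = 1) (p : I)
    {F G : (I → β) → ℝ} (h : ∀ b, ∑ y, w p y * F (Function.update b p y) ≤
      ∑ y, w p y * G (Function.update b p y)) :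
    prodExpect w F ≤ prodExpect w G := by
  rw [← prodExpect_resample hw1 p F, ← prodExpect_resample hw1 p G]
  exact prodExpect_mono hw h

theorem prodExpect_update (hw1 : ∀ i, ∑ y, w i y = 1) (p : I) (v : β → ℝ) (hv : ∑ y, v y = 1)
    {F : (I → β) → ℝ} (hF : ∀ b y, F (Function.update b p y) = F b) :
    prodExpect (Function.update w p v) F = prodExpect w F := by
  have h1 : ∀ b : I → β, (∏ i, Function.update w p v i (b i)) =
      v (b p) * ∏ i ∈ Finset.univ.erase p, w i (b i) := by
    intro b
    rw [prod_weight_eq _ p, Function.update_self]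
    congr 1
    refine Finset.prod_congr rfl fun i hi => ?_
    rw [Function.update_of_ne (Finset.ne_of_mem_erase hi)]
  rw [← prodExpect_resample hw1 p F]
  simp only [prodExpect, h1, hF]
  have h2 : ∀ b : I → β, v (b p) * (∏ i ∈ Finset.univ.erase p, w i (b i)) * F b =
      ∑ y, w p y * (v (b p) * (∏ i ∈ Finset.univ.erase p, w i (b i)) * F b) := by
    intro b
    rw [← Finset.sum_mul, hw1, one_mul]
  rw [Finset.sum_congr rfl fun b _ => h2 b, sum_sum_update p]
  refine Finset.sum_congr rfl fun b _ => ?_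
  rw [← Finset.sum_mul, hw1, one_mul, prod_weight_eq w p]
  calc _ = ∑ y, v y * (w p (b p) * (∏ i ∈ Finset.univ.erase p, w i (b i)) * F b) := by
        refine Finset.sum_congr rfl fun y _ => ?_
        rw [Function.update_self, hF, Finset.prod_congr rfl (g := fun i => w i (b i)) fun i hi => by
          rw [Function.update_of_ne (Finset.ne_of_mem_erase hi)]]
        ring
    _ = _ := by rw [← Finset.sum_mul, hv, one_mul]

theorem prodExpect_congr_weight {w' : I → β → ℝ} (hw1 : ∀ i, ∑ y, w i y = 1)
    (hw1' : ∀ i, ∑ y, w' i y = 1) {F : (I → β) → ℝ}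
    (hF : ∀ p, w p ≠ w' p → ∀ b y, F (Function.update b p y) = F b) :
    prodExpect w F = prodExpect w' F := by
  have key : ∀ s : Finset I, prodExpect (s.piecewise w' w) F = prodExpect w F := by
    intro s
    induction s using Finset.induction_on with
    | empty => rw [Finset.piecewise_empty]
    | insert p s hp ih =>
      rw [Finset.piecewise_insert, ← ih]
      by_cases h : w p = w' p
      · rw [← h, ← Finset.piecewise_eq_of_notMem s w' w hp, Function.update_eq_self]
      · refine prodExpect_update (fun i => ?_) p _ (hw1' p) (hF p h)
        by_cases hi : i ∈ s
        · rw [Finset.piecewise_eq_of_mem s w' w hi, hw1']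
        · rw [Finset.piecewise_eq_of_notMem s w' w hi, hw1]
  rw [← key Finset.univ, Finset.piecewise_univ]

end prodExpect

/-! ### Hit frequencies conditioned on the set of passing blocks. -/

namespace PRSMA

variable {K R : ℕ}

theorem mem_passing {M : Type*} {a : Fin K × Fin R → Option M} {i : Fin K} :
    i ∈ passing a ↔ ∀ t, a (i, t) ≠ none := by
  simp [passing]

/-- The fraction of the runs on block `i` that succeed with a value in the event of interest. -/
def hits (b : Fin K × Fin R → Option Bool) (i : Fin K) : ℝ :=
  (∑ t, if b (i, t) = some true then 1 else 0) / R

theorem hits_nonneg (b : Fin K × Fin R → Option Bool) (i : Fin K) : 0 ≤ hits b i :=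
  div_nonneg (Finset.sum_nonneg fun t _ => by split_ifs <;> norm_num) (Nat.cast_nonneg _)

theorem hits_le_one (b : Fin K × Fin R → Option Bool) (i : Fin K) : hits b i ≤ 1 := by
  refine div_le_one_of_le₀ ?_ (Nat.cast_nonneg _)
  calc _ ≤ ∑ _t : Fin R, (1 : ℝ) :=
        Finset.sum_le_sum fun t _ => by split_ifs <;> norm_num
    _ = R := by simp

theorem passing_update_some (b : Fin K × Fin R → Option Bool) (p : Fin K × Fin R) (y y' : Bool) :
    passing (Function.update b p (some y)) = passing (Function.update b p (some y')) := by
  ext i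
  simp only [mem_passing]
  refine forall_congr' fun t => ?_
  by_cases h : (i, t) = p
  · subst h; simp
  · rw [Function.update_of_ne h, Function.update_of_ne h]

theorem notMem_passing_update_none (b : Fin K × Fin R → Option Bool) (i : Fin K) (t : Fin R) :
    i ∉ passing (Function.update b (i, t) none) := by
  rw [mem_passing]
  push Not
  exact ⟨t, by simp⟩

theorem passing_update_erase (b : Fin K × Fin R → Option Bool) (c : Fin K) (t : Fin R)
    (y : Option Bool) :
    (passing (Function.update b (c, t) y)).erase c = (passing b).erase c := by
  ext i
  simp only [Finset.mem_erase, mem_passing]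
  refine and_congr_right fun hi => forall_congr' fun s => ?_
  rw [Function.update_of_ne (by simp [hi])]

theorem hits_update_of_ne (b : Fin K × Fin R → Option Bool) {c i : Fin K} (hi : i ≠ c) (t : Fin R)
    (y : Option Bool) : hits (Function.update b (c, t) y) i = hits b i := by
  simp only [hits]
  congr 1
  refine Finset.sum_congr rfl fun s _ => ?_
  rw [Function.update_of_ne (by simp [hi])]

section weights

variable {w : Fin K → Option Bool → ℝ}

/-- Redraw the run `(i, t)`. If it fails, `f` vanishes; if it succeeds, its value does not affect
which blocks pass. So its hit probability is conditioned on success only, and dividing by `1 - w i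
none ≥ 1 / 2` costs a factor `2`. -/
theorem prodExpect_passing_mul_indicator_le (hw : ∀ i y, 0 ≤ w i y) (hw1 : ∀ i, ∑ y, w i y = 1)
    (i : Fin K) (t : Fin R) {m : ℝ} (hm : w i (some true) ≤ m) {f : Finset (Fin K) → ℝ}
    (hf : ∀ B, 0 ≤ f B) (hf0 : ∀ B, f B ≠ 0 → i ∈ B ∧ w i none ≤ 1 / 2) :
    prodExpect (fun p : Fin K × Fin R => w p.1)
      (fun b => f (passing b) * if b (i, t) = some true then 1 else 0) ≤
    2 * m * prodExpect (fun p : Fin K × Fin R => w p.1) (fun b => f (passing b)) := by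
  rw [← prodExpect_const_mul]
  refine prodExpect_le_of_resample (fun p => hw p.1) (fun p => hw1 p.1) (i, t) fun b => ?_
  have hnone : f (passing (Function.update b (i, t) none)) = 0 := by
    by_contra h
    exact notMem_passing_update_none b i t (hf0 _ h).1
  have hsum := hw1 i
  simp only [Fintype.sum_option, Fintype.sum_bool, hnone, Function.update_self] at hsum ⊢
  rw [passing_update_some b (i, t) false true]
  set N := f (passing (Function.update b (i, t) (some true))) with hN
  simp only [reduceCtorEq, if_false, if_true, Option.some.injEq, Bool.false_eq_true, mul_zero,
    mul_one, add_zero, zero_add]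
  by_cases h : N = 0
  · simp [h]
  · have h1 := (hf0 _ h).2
    have h2 : 0 ≤ N := hf _
    have h3 := hw i (some true)
    calc w i (some true) * N ≤ m * N := by gcongr
      _ = (1 / 2) * (2 * m * N) := by ring
      _ ≤ (w i (some true) + w i (some false)) * (2 * m * N) := by
          have : 0 ≤ m := h3.trans hm
          gcongr
          linarith
      _ = _ := by ring

/-- Conditioning on success can only increase the hit probability, which is at least `m - w i none`.
-/
theorem mul_prodExpect_passing_le (hw : ∀ i y, 0 ≤ w i y) (hw1 : ∀ i, ∑ y, w i y = 1)
    (i : Fin K) (t : Fin R) {m : ℝ} (hm : m ≤ w i (some true) + w i none)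
    {f : Finset (Fin K) → ℝ} (hf : ∀ B, 0 ≤ f B) (hf0 : ∀ B, f B ≠ 0 → i ∈ B) :
    m * prodExpect (fun p : Fin K × Fin R => w p.1) (fun b => f (passing b)) ≤
    prodExpect (fun p : Fin K × Fin R => w p.1)
      (fun b => f (passing b) * ((if b (i, t) = some true then 1 else 0) + w i none)) := by
  rw [← prodExpect_const_mul]
  refine prodExpect_le_of_resample (fun p => hw p.1) (fun p => hw1 p.1) (i, t) fun b => ?_
  have hnone : f (passing (Function.update b (i, t) none)) = 0 := by
    by_contra h
    exact notMem_passing_update_none b i t (hf0 _ h)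
  have hsum := hw1 i
  simp only [Fintype.sum_option, Fintype.sum_bool, hnone, Function.update_self] at hsum ⊢
  rw [passing_update_some b (i, t) false true]
  set N := f (passing (Function.update b (i, t) (some true))) with hN
  simp only [reduceCtorEq, if_false, if_true, Option.some.injEq, Bool.false_eq_true, mul_zero,
    zero_add, zero_mul]
  have h2 : 0 ≤ N := hf _
  have h3 := hw i (some true)
  have h4 := hw i (some false)
  have h5 := hw i none
  have : (w i (some true) + w i (some false)) * m ≤
      w i (some true) + (w i (some true) + w i (some false)) * w i none := by
    nlinarith
  nlinarith [mul_le_mul_of_nonneg_right this h2]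

theorem prodExpect_passing_mul_hits_le (hR : 0 < R) (hw : ∀ i y, 0 ≤ w i y)
    (hw1 : ∀ i, ∑ y, w i y = 1) (i : Fin K) {m : ℝ} (hm : w i (some true) ≤ m)
    {f : Finset (Fin K) → ℝ} (hf : ∀ B, 0 ≤ f B) (hf0 : ∀ B, f B ≠ 0 → i ∈ B ∧ w i none ≤ 1 / 2) :
    prodExpect (fun p : Fin K × Fin R => w p.1) (fun b => f (passing b) * hits b i) ≤
    2 * m * prodExpect (fun p : Fin K × Fin R => w p.1) (fun b => f (passing b)) := by
  have hR' : (0 : ℝ) < R := by exact_mod_cast hR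
  have h1 : (fun b : Fin K × Fin R → Option Bool => f (passing b) * hits b i) = fun b =>
      (R : ℝ)⁻¹ * ∑ t : Fin R, f (passing b) * if b (i, t) = some true then 1 else 0 := by
    funext b
    rw [hits, ← Finset.mul_sum]; ring
  rw [h1, prodExpect_const_mul, prodExpect_sum, inv_mul_le_iff₀ hR']
  calc _ ≤ ∑ _t : Fin R, 2 * m *
        prodExpect (fun p : Fin K × Fin R => w p.1) (fun b => f (passing b)) :=
        Finset.sum_le_sum fun t _ => prodExpect_passing_mul_indicator_le hw hw1 i t hm hf hf0
    _ = _ := by simp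

theorem mul_prodExpect_passing_le_hits (hR : 0 < R) (hw : ∀ i y, 0 ≤ w i y)
    (hw1 : ∀ i, ∑ y, w i y = 1) (i : Fin K) {m : ℝ} (hm : m ≤ w i (some true) + w i none)
    {f : Finset (Fin K) → ℝ} (hf : ∀ B, 0 ≤ f B) (hf0 : ∀ B, f B ≠ 0 → i ∈ B) :
    m * prodExpect (fun p : Fin K × Fin R => w p.1) (fun b => f (passing b)) ≤
    prodExpect (fun p : Fin K × Fin R => w p.1) (fun b => f (passing b) * (hits b i + w i none)) := by
  have hR' : (0 : ℝ) < R := by exact_mod_cast hR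
  have h1 : (fun b : Fin K × Fin R → Option Bool => f (passing b) * (hits b i + w i none)) = fun b =>
      (R : ℝ)⁻¹ * ∑ t : Fin R, f (passing b) *
        ((if b (i, t) = some true then 1 else 0) + w i none) := by
    funext b
    rw [hits, ← Finset.mul_sum, Finset.sum_add_distrib, Finset.sum_const, Finset.card_univ,
      Fintype.card_fin, nsmul_eq_mul]
    field_simp
  rw [h1, prodExpect_const_mul, prodExpect_sum, le_inv_mul_iff₀ hR']
  calc _ = ∑ _t : Fin R, m *
        prodExpect (fun p : Fin K × Fin R => w p.1) (fun b => f (passing b)) := by simp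
    _ ≤ _ := Finset.sum_le_sum fun t _ => mul_prodExpect_passing_le hw hw1 i t hm hf hf0

open Classical in
theorem prodExpect_mem_passing (hw1 : ∀ i, ∑ y, w i y = 1) (i : Fin K) :
    prodExpect (fun p : Fin K × Fin R => w p.1) (fun b => if i ∈ passing b then 1 else 0) =
      (1 - w i none) ^ R := by
  have h1 : (fun b : Fin K × Fin R → Option Bool => if i ∈ passing b then (1 : ℝ) else 0) =
      fun b => ∏ p : Fin K × Fin R, if p.1 = i ∧ b p = none then (0 : ℝ) else 1 := by
    funext b
    split_ifs with h
    · rw [mem_passing] at h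
      refine (Finset.prod_eq_one fun p _ => if_neg ?_).symm
      rintro ⟨rfl, hp⟩
      exact h p.2 hp
    · rw [mem_passing] at h
      push Not at h
      obtain ⟨t, ht⟩ := h
      exact (Finset.prod_eq_zero (Finset.mem_univ (i, t)) (by simp [ht])).symm
  rw [h1, prodExpect_prod (w := fun p : Fin K × Fin R => w p.1)
    (fun p y => if p.1 = i ∧ y = none then (0 : ℝ) else 1), Fintype.prod_prod_type]
  have h2 : ∀ j : Fin K, (∑ y, w j y * if j = i ∧ y = none then (0 : ℝ) else 1) =
      if j = i then 1 - w i none else 1 := by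
    intro j
    have hj := hw1 j
    simp only [Fintype.sum_option, Fintype.sum_bool] at hj ⊢
    by_cases h : j = i
    · subst h
      simp only [and_true, if_true, mul_zero, zero_add, reduceCtorEq, and_false, if_false, mul_one]
      linarith
    · simp only [h, false_and, if_false, mul_one]
      linarith
  simp only [h2, Finset.prod_const, Finset.card_univ, Fintype.card_fin, Finset.prod_pow]
  simp

open Classical in
-- Union bound over the blocks of failure probability above `d`, each of which passes with
-- probability at most `d / K`.
theorem prodExpect_exists_mem_passing_le (hw : ∀ i y, 0 ≤ w i y) (hw1 : ∀ i, ∑ y, w i y = 1)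
    {d : ℝ} (hd : 0 ≤ d) (hpass : ∀ f, d < f → f ≤ 1 → (1 - f) ^ R ≤ d / K) :
    prodExpect (fun p : Fin K × Fin R => w p.1)
      (fun b => if ∃ i ∈ passing b, d < w i none then 1 else 0) ≤ d := by
  calc _ ≤ prodExpect (fun p : Fin K × Fin R => w p.1) (fun b => ∑ i : Fin K,
          (if d < w i none then 1 else 0) * (if i ∈ passing b then 1 else 0)) := by
        refine prodExpect_mono (fun p : Fin K × Fin R => hw p.1) fun b => ?_
        split_ifs with h
        · obtain ⟨i, hi, hid⟩ := h
          refine le_trans ?_ (Finset.single_le_sum (fun j _ => by positivity) (Finset.mem_univ i))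
          simp [hi, hid]
        · positivity
    _ = ∑ i, (if d < w i none then 1 else 0) * (1 - w i none) ^ R := by
        rw [prodExpect_sum]
        refine Finset.sum_congr rfl fun i _ => ?_
        rw [prodExpect_const_mul, prodExpect_mem_passing hw1]
    _ ≤ ∑ _i : Fin K, d / K := by
        refine Finset.sum_le_sum fun i _ => ?_
        split_ifs with h
        · rw [one_mul]
          refine hpass _ h ?_
          have hs := hw1 i
          simp only [Fintype.sum_option, Fintype.sum_bool] at hs
          linarith [hw i (some true), hw i (some false)]
        · rw [zero_mul]; positivity
    _ ≤ d := by
        rw [Finset.sum_const, Finset.card_univ, Fintype.card_fin, nsmul_eq_mul]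
        rcases Nat.eq_zero_or_pos K with rfl | hK
        · simpa using hd
        · rw [mul_div_cancel₀]
          positivity

end weights

end PRSMA

end

/-! ### Effect of ignoring one block, for fixed results of all runs. -/

noncomputable section

namespace PRSMA

variable {K R : ℕ}

/-- The probability of an event given the results of all runs, if the release probability for `T`
passing blocks is `L T`, and `ν` is the indicator of failure belonging to the event. -/
def eventProb (L : ℕ → ℝ) (ν : ℝ) (b : Fin K × Fin R → Option Bool) : ℝ :=
  L (passing b).card * ((∑ i ∈ passing b, hits b i) / (passing b).card) +
    (1 - L (passing b).card) * ν

/-- `eventProb` with block `c` ignored. -/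
def eventProbErase (L : ℕ → ℝ) (ν : ℝ) (c : Fin K) (b : Fin K × Fin R → Option Bool) : ℝ :=
  L ((passing b).erase c).card *
    ((∑ i ∈ (passing b).erase c, hits b i) / ((passing b).erase c).card) +
    (1 - L ((passing b).erase c).card) * ν

theorem sum_hits_div_nonneg (b : Fin K × Fin R → Option Bool) (B : Finset (Fin K)) :
    0 ≤ (∑ i ∈ B, hits b i) / B.card :=
  div_nonneg (Finset.sum_nonneg fun i _ => hits_nonneg b i) (Nat.cast_nonneg _)

theorem sum_hits_div_le_one (b : Fin K × Fin R → Option Bool) (B : Finset (Fin K)) :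
    (∑ i ∈ B, hits b i) / B.card ≤ 1 := by
  refine div_le_one_of_le₀ ?_ (Nat.cast_nonneg _)
  calc _ ≤ ∑ _i ∈ B, (1 : ℝ) := Finset.sum_le_sum fun i _ => hits_le_one b i
    _ = B.card := by simp

theorem eventProb_le_one {L : ℕ → ℝ} (hL0 : ∀ T, 0 ≤ L T) (hL1 : ∀ T, L T ≤ 1) {ν : ℝ}
    (hν1 : ν ≤ 1) (b : Fin K × Fin R → Option Bool) : eventProb L ν b ≤ 1 := by
  have h1 := sum_hits_div_le_one b (passing b)
  have h2 := hL0 (passing b).card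
  have h3 := hL1 (passing b).card
  rw [eventProb]
  nlinarith

theorem eventProbErase_nonneg {L : ℕ → ℝ} (hL0 : ∀ T, 0 ≤ L T) (hL1 : ∀ T, L T ≤ 1) {ν : ℝ}
    (hν0 : 0 ≤ ν) (c : Fin K) (b : Fin K × Fin R → Option Bool) : 0 ≤ eventProbErase L ν c b :=
  add_nonneg (mul_nonneg (hL0 _) (sum_hits_div_nonneg b _))
    (mul_nonneg (sub_nonneg.2 (hL1 _)) hν0)

theorem eventProbErase_update (L : ℕ → ℝ) (ν : ℝ) (c : Fin K) (b : Fin K × Fin R → Option Bool)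
    (t : Fin R) (y : Option Bool) :
    eventProbErase L ν c (Function.update b (c, t) y) = eventProbErase L ν c b := by
  simp only [eventProbErase, passing_update_erase]
  congr 3
  exact Finset.sum_congr rfl fun i hi => hits_update_of_ne b (Finset.ne_of_mem_erase hi) t y

/-- The assumptions on the release probabilities as a function of the number of passing blocks. -/
structure IsReleaseProb (e d : ℝ) (L : ℕ → ℝ) : Prop where
  nonneg : ∀ T, 0 ≤ L T
  le_one : ∀ T, L T ≤ 1
  le_half : ∀ T : ℕ, (T : ℝ) ≤ 1 / e → L T ≤ d / 2
  mono : ∀ T, 1 ≤ T → L T ≤ L (T + 1)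
  -- Only from `T = 1`: the release probability is forced to `0` at `T = 0`, where this bound can
  -- fail.
  succ_le : ∀ T, 1 ≤ T → L (T + 1) ≤ Real.exp e * L T
  one_sub_le : ∀ T, 1 ≤ T → 1 - L T ≤ Real.exp e * (1 - L (T + 1))

section pointwise

variable {e d ν : ℝ} {L : ℕ → ℝ}

theorem eventProb_le_of_small (hL : IsReleaseProb e d L) (hν0 : 0 ≤ ν) {b : Fin K × Fin R → Option Bool}
    (hb : ((passing b).card : ℝ) ≤ 1 / e) : eventProb L ν b ≤ ν + d / 2 := by
  have h1 := sum_hits_div_le_one b (passing b)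
  have h2 := hL.nonneg (passing b).card
  have h3 := hL.le_half (passing b).card hb
  rw [eventProb]
  nlinarith

theorem le_eventProb_of_small (hL : IsReleaseProb e d L) (hν1 : ν ≤ 1) {b : Fin K × Fin R → Option Bool}
    (hb : ((passing b).card : ℝ) ≤ 1 / e) : ν - d / 2 ≤ eventProb L ν b := by
  have h1 := sum_hits_div_nonneg b (passing b)
  have h2 := hL.nonneg (passing b).card
  have h3 := hL.le_half (passing b).card hb
  rw [eventProb]
  nlinarith [mul_nonneg h2 h1]

theorem card_passing_le (b : Fin K × Fin R → Option Bool) (c : Fin K) :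
    (passing b).card ≤ ((passing b).erase c).card + 1 := by
  by_cases h : c ∈ passing b
  · rw [Finset.card_erase_add_one h]
  · rw [Finset.erase_eq_of_notMem h]; omega

theorem one_le_of_big (he : 0 < e) (he2 : e ≤ 1 / 2) {T : ℕ} (hT : 1 / e < (T : ℝ) + 1) :
    1 ≤ T := by
  have : 2 ≤ 1 / e := by rw [le_div_iff₀ he]; linarith
  have h : (1 : ℝ) < T := by linarith
  exact_mod_cast h.le

/-- Adding `c` lowers the share of the other blocks and raises the release probability by at most
`exp e`. The last term is the share of `c`, about which nothing is known yet. -/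
theorem eventProb_le_of_big (hL : IsReleaseProb e d L) (he : 0 < e) (he2 : e ≤ 1 / 2) (hν0 : 0 ≤ ν) (c : Fin K)
    {b : Fin K × Fin R → Option Bool} (hb : 1 / e < (((passing b).erase c).card : ℝ) + 1) :
    eventProb L ν b ≤ Real.exp e * eventProbErase L ν c b +
      if c ∈ passing b then L (((passing b).erase c).card + 1) /
        (((passing b).erase c).card + 1) * hits b c else 0 := by
  have hG := eventProbErase_nonneg hL.nonneg hL.le_one hν0 c b
  have hexp : 1 ≤ Real.exp e := Real.one_le_exp he.le
  have hT1 := one_le_of_big he he2 hb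
  split_ifs with h
  · have hcard := Finset.card_erase_add_one h
    have hsum := Finset.add_sum_erase _ (fun i => hits b i) h
    rw [eventProb, eventProbErase, ← hcard, ← hsum]
    have hS : 0 ≤ ∑ i ∈ (passing b).erase c, hits b i :=
      Finset.sum_nonneg fun i _ => hits_nonneg b i
    set T := ((passing b).erase c).card
    set S := ∑ i ∈ (passing b).erase c, hits b i
    have hT : (0 : ℝ) < T := by exact_mod_cast hT1
    have h1 := hL.mono T hT1
    have h2 := hL.succ_le T hT1
    have h3 : S / (T + 1) ≤ S / T := by gcongr; linarith
    have h4 : L (T + 1) * (S / (T + 1)) ≤ Real.exp e * L T * (S / T) := by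
      have := hL.nonneg T
      gcongr
    have h5 : (1 - L (T + 1)) * ν ≤ Real.exp e * ((1 - L T) * ν) := by
      have h6 : 0 ≤ (1 - L T) * ν := mul_nonneg (sub_nonneg.2 (hL.le_one T)) hν0
      calc (1 - L (T + 1)) * ν ≤ (1 - L T) * ν := by gcongr
        _ ≤ _ := le_mul_of_one_le_left h6 hexp
    push_cast
    rw [add_div, mul_add, mul_div_assoc', div_mul_eq_mul_div]
    linarith
  · rw [eventProb, eventProbErase] at *
    rw [Finset.erase_eq_of_notMem h] at *
    rw [add_zero]
    exact le_mul_of_one_le_left hG hexp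

/-- In this direction the hits on `c` are simply dropped. The losses are the dilution factor `(T +
1) / T` and the noise factor for not releasing. -/
theorem eventProbErase_le_of_big (hL : IsReleaseProb e d L) (he : 0 < e) (he2 : e ≤ 1 / 2) (hν0 : 0 ≤ ν) (c : Fin K)
    {b : Fin K × Fin R → Option Bool} (hb : 1 / e < (((passing b).erase c).card : ℝ) + 1) :
    eventProbErase L ν c b ≤ Real.exp (3 * e) * eventProb L ν b := by
  have hT1 := one_le_of_big he he2 hb
  by_cases h : c ∈ passing b
  · have hcard := Finset.card_erase_add_one h
    have hsum := Finset.add_sum_erase _ (fun i => hits b i) h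
    rw [eventProb, eventProbErase, ← hcard, ← hsum]
    have hS : 0 ≤ ∑ i ∈ (passing b).erase c, hits b i :=
      Finset.sum_nonneg fun i _ => hits_nonneg b i
    have hc := hits_nonneg b c
    set T := ((passing b).erase c).card
    set S := ∑ i ∈ (passing b).erase c, hits b i
    have hT : (0 : ℝ) < T := by exact_mod_cast hT1
    have h1 := hL.mono T hT1
    have h2 := hL.one_sub_le T hT1
    have hexp2 : 1 + 2 * e ≤ Real.exp (2 * e) := by linarith [Real.add_one_le_exp (2 * e)]
    have hexp3 : Real.exp e ≤ Real.exp (3 * e) := Real.exp_le_exp.2 (by linarith)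
    have hexp4 : Real.exp (2 * e) ≤ Real.exp (3 * e) := Real.exp_le_exp.2 (by linarith)
    have h3 : S / T ≤ Real.exp (3 * e) * ((hits b c + S) / (T + 1)) := by
      -- From `1 < e * (T + 1)` and `e ≤ 1 / 2`; hence `(T + 1) / T ≤ 1 + 2 * e`.
      have hTe : 1 ≤ 2 * e * T := by
        rw [div_lt_iff₀ he] at hb
        nlinarith
      rw [mul_div_assoc', div_le_div_iff₀ hT (by positivity)]
      calc S * (T + 1) ≤ S * ((1 + 2 * e) * T) := by
            gcongr
            linarith
        _ = (1 + 2 * e) * S * T := by ring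
        _ ≤ Real.exp (3 * e) * (hits b c + S) * T := by
            gcongr
            · linarith
            · linarith
    have h4 : L T * (S / T) ≤ L (T + 1) * (Real.exp (3 * e) * ((hits b c + S) / (T + 1))) := by
      have := hL.nonneg (T + 1)
      gcongr
    have h5 : (1 - L T) * ν ≤ Real.exp (3 * e) * (1 - L (T + 1)) * ν := by
      have := sub_nonneg.2 (hL.le_one (T + 1))
      refine mul_le_mul_of_nonneg_right (h2.trans ?_) hν0
      gcongr
    push_cast
    linarith
  · have hG := eventProbErase_nonneg hL.nonneg hL.le_one hν0 c b
    rw [eventProb, eventProbErase] at *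
    rw [Finset.erase_eq_of_notMem h] at *
    exact le_mul_of_one_le_left hG (Real.one_le_exp (by positivity))

end pointwise

end PRSMA
end

/-! ### Comparison of two data sets that differ in one block. -/

noncomputable section

namespace PRSMA

variable {K R : ℕ}

section core

variable {e d ν : ℝ} {L : ℕ → ℝ} {w : Fin K → Option Bool → ℝ}

open Classical in
/-- The weight given to the runs on block `c` if exactly the blocks in `B` pass. -/
def ownWeight (e d : ℝ) (L : ℕ → ℝ) (w : Fin K → Option Bool → ℝ) (c : Fin K)
    (B : Finset (Fin K)) : ℝ :=
  if c ∈ B ∧ 1 / e < ((B.erase c).card : ℝ) + 1 ∧ ∀ i ∈ B, w i none ≤ d then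
    L ((B.erase c).card + 1) / ((B.erase c).card + 1) else 0

theorem ownWeight_nonneg (hL : IsReleaseProb e d L) (c : Fin K) (B : Finset (Fin K)) :
    0 ≤ ownWeight e d L w c B := by
  have := hL.nonneg ((B.erase c).card + 1)
  rw [ownWeight]
  positivity

theorem ownWeight_ne_zero {c : Fin K} {B : Finset (Fin K)} (h : ownWeight e d L w c B ≠ 0) :
    c ∈ B ∧ 1 / e < ((B.erase c).card : ℝ) + 1 ∧ ∀ i ∈ B, w i none ≤ d := by
  by_contra h'
  exact h (if_neg h')

theorem ownWeight_le (hL : IsReleaseProb e d L) (he : 0 < e) (c : Fin K) (B : Finset (Fin K)) :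
    ownWeight e d L w c B ≤ e := by
  rw [ownWeight]
  split_ifs with h
  · have h2 := h.2.1
    rw [div_lt_iff₀ he] at h2
    rw [div_le_iff₀ (by positivity)]
    linarith [hL.le_one ((B.erase c).card + 1)]
  · exact he.le

open Classical in
-- The weight of one block is at most `1 / (T + 1) < e`. This factor `e` is what makes a
-- constant-factor comparison between blocks sufficient.
theorem ownWeight_mul_sum_hits_le (hL : IsReleaseProb e d L) (he : 0 < e) (he2 : e ≤ 1 / 2)
    (hν0 : 0 ≤ ν) (c : Fin K) (b : Fin K × Fin R → Option Bool) :
    ownWeight e d L w c (passing b) *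
        ((∑ i ∈ (passing b).erase c, hits b i) / ((passing b).erase c).card) ≤
      e * Real.exp e * ((if 1 / e < (((passing b).erase c).card : ℝ) + 1 then 1 else 0) *
        eventProbErase L ν c b) := by
  have hG := eventProbErase_nonneg hL.nonneg hL.le_one hν0 c b
  have hS := sum_hits_div_nonneg b ((passing b).erase c)
  by_cases h : ownWeight e d L w c (passing b) = 0
  · rw [h, zero_mul]
    positivity
  · have h' := ownWeight_ne_zero h
    rw [ownWeight, if_pos h', if_pos h'.2.1, one_mul]
    have hT1 := one_le_of_big he he2 h'.2.1
    have h1 := hL.succ_le _ hT1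
    have h2 : 1 / ((((passing b).erase c).card : ℝ) + 1) ≤ e := by
      have := h'.2.1
      rw [div_lt_iff₀ he] at this
      rw [div_le_iff₀ (by positivity)]
      linarith
    have h3 : L ((passing b).erase c).card *
        ((∑ i ∈ (passing b).erase c, hits b i) / ((passing b).erase c).card) ≤
        eventProbErase L ν c b :=
      le_add_of_nonneg_right (mul_nonneg (sub_nonneg.2 (hL.le_one _)) hν0)
    have h4 := hL.nonneg (((passing b).erase c).card + 1)
    calc _ = (1 / ((((passing b).erase c).card : ℝ) + 1)) * (L (((passing b).erase c).card + 1) *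
          ((∑ i ∈ (passing b).erase c, hits b i) / ((passing b).erase c).card)) := by ring
      _ ≤ e * (Real.exp e * L ((passing b).erase c).card *
          ((∑ i ∈ (passing b).erase c, hits b i) / ((passing b).erase c).card)) := by gcongr
      _ = e * Real.exp e * (L ((passing b).erase c).card *
          ((∑ i ∈ (passing b).erase c, hits b i) / ((passing b).erase c).card)) := by ring
      _ ≤ _ := by gcongr

open Classical in
-- The hits on `c` are charged to the other passing blocks. The weight of `c` is split evenly among
-- them (`g`), and hit probabilities are transferred through the reference value: `m c ≤ x * q + U`
-- and `q ≤ x * m i + D i`. This gives `x ^ 2`; the factor `2` comes from conditioning on passing.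
theorem prodExpect_ownWeight_mul_hits_le (hR : 0 < R) (he : 0 < e) (he2 : e ≤ 1 / 2)
    (hd : 0 < d) (hd2 : d ≤ 1 / 2) (hL : IsReleaseProb e d L) (hν0 : 0 ≤ ν)
    (hw : ∀ i y, 0 ≤ w i y) (hw1 : ∀ i, ∑ y, w i y = 1) (c : Fin K)
    {m : Fin K → ℝ} (hm : ∀ i, w i (some true) ≤ m i)
    (hm' : ∀ i, m i ≤ w i (some true) + w i none)
    {x q U : ℝ} {D : Fin K → ℝ} (hx : 0 ≤ x) (hU0 : 0 ≤ U) (hD0 : ∀ i, 0 ≤ D i)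
    (hU : m c ≤ x * q + U) (hD : ∀ i, q ≤ x * m i + D i) :
    prodExpect (fun p : Fin K × Fin R => w p.1)
        (fun b => ownWeight e d L w c (passing b) * hits b c) ≤
      2 * x ^ 2 * e * Real.exp e * prodExpect (fun p : Fin K × Fin R => w p.1) (fun b =>
        (if 1 / e < (((passing b).erase c).card : ℝ) + 1 then 1 else 0) *
          eventProbErase L ν c b) +
      2 * e * (x ^ 2 * d + x * (∑ i, D i) + U) := by
  set W : Fin K × Fin R → Option Bool → ℝ := fun p => w p.1 with hW
  have hW0 : ∀ p y, 0 ≤ W p y := fun p => hw p.1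
  have hW1 : ∀ p, ∑ y, W p y = 1 := fun p => hw1 p.1
  set f : Finset (Fin K) → ℝ := ownWeight e d L w c with hf
  have hf0 : ∀ B, 0 ≤ f B := ownWeight_nonneg hL c
  set EG := prodExpect W (fun b =>
    (if 1 / e < (((passing b).erase c).card : ℝ) + 1 then 1 else 0) * eventProbErase L ν c b)
    with hEG
  set Ef := prodExpect W (fun b => f (passing b)) with hEf
  have hEf0 : 0 ≤ Ef := prodExpect_nonneg hW0 fun b => hf0 _
  have hEfe : Ef ≤ e := by
    rw [← prodExpect_const hW1 e]
    exact prodExpect_mono hW0 fun b => ownWeight_le hL he c _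
  have hSD : 0 ≤ ∑ i, D i := Finset.sum_nonneg fun i _ => hD0 i
  -- the weights of the other blocks
  set g : Fin K → Finset (Fin K) → ℝ := fun i B => if i ∈ B.erase c then f B / (B.erase c).card else 0
    with hg
  have hg0 : ∀ i B, 0 ≤ g i B := fun i B => by
    have := hf0 B
    simp only [hg]
    positivity
  have hgne : ∀ i B, g i B ≠ 0 → i ∈ B ∧ w i none ≤ d := by
    intro i B h
    have h1 : i ∈ B.erase c := by
      by_contra h'
      exact h (if_neg h')
    have h2 : f B ≠ 0 := by
      intro h'
      apply h
      simp [hg, h']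
    exact ⟨Finset.mem_of_mem_erase h1, (ownWeight_ne_zero h2).2.2 i (Finset.mem_of_mem_erase h1)⟩
  have hgsum : ∀ B (a : Fin K → ℝ), ∑ i, g i B * a i =
      f B * ((∑ i ∈ B.erase c, a i) / (B.erase c).card) := by
    intro B a
    simp only [hg, ite_mul, zero_mul]
    rw [Finset.sum_ite_mem, Finset.univ_inter, Finset.sum_div, Finset.mul_sum]
    exact Finset.sum_congr rfl fun i _ => by ring
  have hgone : ∀ B, ∑ i, g i B = f B := by
    intro B
    have := hgsum B fun _ => 1
    simp only [mul_one, Finset.sum_const, nsmul_eq_mul] at this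
    rw [this]
    by_cases h : f B = 0
    · simp [h]
    · have hT := one_le_of_big he he2 (ownWeight_ne_zero h).2.1
      have : ((B.erase c).card : ℝ) ≠ 0 := by positivity
      rw [div_self this, mul_one]
  set Eg : Fin K → ℝ := fun i => prodExpect W (fun b => g i (passing b)) with hEgdef
  have hEg0 : ∀ i, 0 ≤ Eg i := fun i => prodExpect_nonneg hW0 fun b => hg0 _ _
  have hEgsum : ∑ i, Eg i = Ef := by
    rw [hEf, hEgdef, ← prodExpect_sum]
    congr 1
    funext b
    exact hgone _
  have hmg : ∀ i, m i * Eg i ≤ prodExpect W (fun b => g i (passing b) * hits b i) + d * Eg i := by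
    intro i
    refine (mul_prodExpect_passing_le_hits hR hw hw1 i (hm' i) (hg0 i)
      (fun B h => (hgne i B h).1)).trans ?_
    rw [← prodExpect_const_mul, ← prodExpect_add]
    refine prodExpect_mono hW0 fun b => ?_
    by_cases h : g i (passing b) = 0
    · simp [h]
    · have h1 := (hgne i _ h).2
      have h2 := hg0 i (passing b)
      nlinarith
  have hsum_hits : ∑ i, prodExpect W (fun b => g i (passing b) * hits b i) ≤
      e * Real.exp e * EG := by
    rw [← prodExpect_sum, hEG, ← prodExpect_const_mul]
    refine prodExpect_mono hW0 fun b => ?_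
    rw [hgsum]
    exact ownWeight_mul_sum_hits_le hL he he2 hν0 c b
  -- Each share of the weight is bounded through its own block `i`, so the average hit frequency of
  -- the other blocks appears.
  have hqEf : q * Ef ≤ x * (e * Real.exp e * EG + d * Ef) + (∑ i, D i) * Ef := by
    calc q * Ef = ∑ i, q * Eg i := by rw [← hEgsum, Finset.mul_sum]
      _ ≤ ∑ i, (x * (prodExpect W (fun b => g i (passing b) * hits b i) + d * Eg i) +
          D i * Eg i) := by
        refine Finset.sum_le_sum fun i _ => ?_
        calc q * Eg i ≤ (x * m i + D i) * Eg i := mul_le_mul_of_nonneg_right (hD i) (hEg0 i)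
          _ = x * (m i * Eg i) + D i * Eg i := by ring
          _ ≤ _ := by
            gcongr
            exact hmg i
      _ = x * (∑ i, prodExpect W (fun b => g i (passing b) * hits b i) + d * Ef) +
          ∑ i, D i * Eg i := by
        rw [Finset.sum_add_distrib, ← Finset.mul_sum, Finset.sum_add_distrib, ← Finset.mul_sum,
          hEgsum]
      _ ≤ _ := by
        gcongr
        rw [Finset.sum_mul]
        refine Finset.sum_le_sum fun i _ => mul_le_mul_of_nonneg_left ?_ (hD0 i)
        rw [← hEgsum]
        exact Finset.single_le_sum (fun j _ => hEg0 j) (Finset.mem_univ i)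
  have hmain := prodExpect_passing_mul_hits_le hR hw hw1 c (hm c) hf0 fun B h =>
    ⟨(ownWeight_ne_zero h).1,
      ((ownWeight_ne_zero h).2.2 c (ownWeight_ne_zero h).1).trans hd2⟩
  calc _ ≤ 2 * m c * Ef := hmain
    _ ≤ 2 * (x * q + U) * Ef := by gcongr
    _ = 2 * x * (q * Ef) + 2 * U * Ef := by ring
    _ ≤ 2 * x * (x * (e * Real.exp e * EG + d * Ef) + (∑ i, D i) * Ef) + 2 * U * Ef := by gcongr
    _ = 2 * x ^ 2 * e * Real.exp e * EG + 2 * Ef * (x ^ 2 * d + x * (∑ i, D i) + U) := by ring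
    _ ≤ _ := by gcongr

/-- The outputs on two data sets that differ in block `c` only are close, if the base algorithm
has similar output distributions on all blocks of the first data set. -/
theorem prodExpect_eventProb_le (hR : 0 < R) (he : 0 < e) (he2 : e ≤ 1 / 2)
    (hd : 0 < d) (hd2 : d ≤ 1 / 2) (hL : IsReleaseProb e d L) (hν0 : 0 ≤ ν) (hν1 : ν ≤ 1)
    {w' : Fin K → Option Bool → ℝ}
    (hw : ∀ i y, 0 ≤ w i y) (hw1 : ∀ i, ∑ y, w i y = 1)
    (hw' : ∀ i y, 0 ≤ w' i y) (hw1' : ∀ i, ∑ y, w' i y = 1) (c : Fin K)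
    (hww' : ∀ i, i ≠ c → w i = w' i) (hpass : ∀ f, d < f → f ≤ 1 → (1 - f) ^ R ≤ d / K)
    {m : Fin K → ℝ} (hm : ∀ i, w i (some true) ≤ m i)
    (hm' : ∀ i, m i ≤ w i (some true) + w i none)
    {x q U : ℝ} {D : Fin K → ℝ} (hx : 0 ≤ x) (hU0 : 0 ≤ U) (hD0 : ∀ i, 0 ≤ D i)
    (hU : m c ≤ x * q + U) (hD : ∀ i, q ≤ x * m i + D i) :
    prodExpect (fun p : Fin K × Fin R => w p.1) (eventProb L ν) ≤
      Real.exp ((4 + 2 * x ^ 2) * e) *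
        prodExpect (fun p : Fin K × Fin R => w' p.1) (eventProb L ν) +
      (2 * d + 2 * e * (x ^ 2 * d + x * (∑ i, D i) + U)) := by
  classical
  set W : Fin K × Fin R → Option Bool → ℝ := fun p => w p.1 with hW
  have hW0 : ∀ p y, 0 ≤ W p y := fun p => hw p.1
  have hW1 : ∀ p, ∑ y, W p y = 1 := fun p => hw1 p.1
  set W' : Fin K × Fin R → Option Bool → ℝ := fun p => w' p.1 with hW'
  have hW0' : ∀ p y, 0 ≤ W' p y := fun p => hw' p.1
  have hW1' : ∀ p, ∑ y, W' p y = 1 := fun p => hw1' p.1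
  set big : (Fin K × Fin R → Option Bool) → ℝ := fun b =>
    if 1 / e < (((passing b).erase c).card : ℝ) + 1 then 1 else 0 with hbig
  set C : ℝ := Real.exp e * (1 + 2 * x ^ 2 * e) with hC
  have hG := eventProbErase_nonneg (R := R) hL.nonneg hL.le_one hν0 c
  -- If few blocks pass, the output is essentially failure, of value `ν`. Otherwise `c` is split
  -- off, and `d` pays for passing blocks with large failure probability.
  have hstep1 : prodExpect W (eventProb L ν) ≤
      prodExpect W (fun b => (1 - big b) * (ν + d / 2)) +
      Real.exp e * prodExpect W (fun b => big b * eventProbErase L ν c b) + d +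
      prodExpect W (fun b => ownWeight e d L w c (passing b) * hits b c) := by
    have hbad := prodExpect_exists_mem_passing_le (R := R) hw hw1 hd.le hpass
    refine le_trans ?_ (add_le_add_left (add_le_add_right hbad _) _)
    rw [← prodExpect_const_mul, ← prodExpect_add, ← prodExpect_add, ← prodExpect_add]
    refine prodExpect_mono hW0 fun b => ?_
    have hown : 0 ≤ ownWeight e d L w c (passing b) * hits b c :=
      mul_nonneg (ownWeight_nonneg hL c _) (hits_nonneg b c)
    by_cases hb : 1 / e < (((passing b).erase c).card : ℝ) + 1
    · have hb1 : big b = 1 := if_pos hb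
      rw [hb1, sub_self, zero_mul, one_mul, zero_add]
      split_ifs with hbad
      · have := eventProb_le_one hL.nonneg hL.le_one hν1 b
        have h2 := mul_nonneg (Real.exp_pos e).le (hG b)
        linarith
      · push Not at hbad
        have := eventProb_le_of_big hL he he2 hν0 c hb
        rw [add_zero]
        refine this.trans (add_le_add_right ?_ _)
        split_ifs with hc
        · rw [ownWeight, if_pos ⟨hc, hb, hbad⟩]
        · exact hown
    · have hb0 : big b = 0 := if_neg hb
      have hcard : ((passing b).card : ℝ) ≤ 1 / e := by
        refine le_trans ?_ (not_lt.1 hb)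
        exact_mod_cast card_passing_le b c
      have := eventProb_le_of_small hL hν0 hcard
      rw [hb0, sub_zero, one_mul, zero_mul, mul_zero, add_zero]
      have h3 : (0 : ℝ) ≤ if ∃ i ∈ passing b, d < w i none then 1 else 0 := by positivity
      linarith
  have hstep2 := prodExpect_ownWeight_mul_hits_le hR he he2 hd hd2 hL hν0 hw hw1 c hm hm' hx hU0 hD0
    hU hD
  -- The intermediate quantity does not depend on the runs on `c`, so the two data sets give it the
  -- same expectation.
  have hswap : prodExpect W (fun b => (1 - big b) * (ν + d / 2) + C * (big b * eventProbErase L ν c b)) =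
      prodExpect W' (fun b => (1 - big b) * (ν + d / 2) + C * (big b * eventProbErase L ν c b)) := by
    refine prodExpect_congr_weight hW1 hW1' fun p hp b y => ?_
    have hpc : p.1 = c := by
      by_contra h
      exact hp (hww' _ h)
    obtain ⟨i, t⟩ := p
    simp only at hpc
    subst hpc
    simp only [hbig, passing_update_erase, eventProbErase_update]
  have hC1 : 1 ≤ C := by
    have h1 : 1 ≤ Real.exp e := Real.one_le_exp he.le
    have h2 : 1 ≤ 1 + 2 * x ^ 2 * e := by
      have : 0 ≤ 2 * x ^ 2 * e := by positivity
      linarith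
    exact one_le_mul_of_one_le_of_one_le h1 h2
  -- Exponents: `e` for leaving out `c`, `3 * e` for putting it back, `2 * x ^ 2 * e` for the
  -- results of `c` itself.
  have hCexp : C * Real.exp (3 * e) ≤ Real.exp ((4 + 2 * x ^ 2) * e) := by
    have h1 : 1 + 2 * x ^ 2 * e ≤ Real.exp (2 * x ^ 2 * e) := by
      linarith [Real.add_one_le_exp (2 * x ^ 2 * e)]
    calc C * Real.exp (3 * e) ≤ Real.exp e * Real.exp (2 * x ^ 2 * e) * Real.exp (3 * e) := by
          rw [hC]; gcongr
      _ = _ := by rw [← Real.exp_add, ← Real.exp_add]; ring_nf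
  have hstep3 : prodExpect W' (fun b => (1 - big b) * (ν + d / 2) +
      C * (big b * eventProbErase L ν c b)) ≤
      Real.exp ((4 + 2 * x ^ 2) * e) * prodExpect W' (eventProb L ν) + d := by
    rw [← prodExpect_const hW1' d, ← prodExpect_const_mul, ← prodExpect_add]
    refine prodExpect_mono hW0' fun b => ?_
    rw [prodExpect_const hW1' d]
    have hΨ0 : 0 ≤ eventProb L ν b :=
      add_nonneg (mul_nonneg (hL.nonneg _) (sum_hits_div_nonneg b _))
        (mul_nonneg (sub_nonneg.2 (hL.le_one _)) hν0)
    refine le_trans ?_ (add_le_add_left (mul_le_mul_of_nonneg_right hCexp hΨ0) _)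
    by_cases hb : 1 / e < (((passing b).erase c).card : ℝ) + 1
    · have hb1 : big b = 1 := if_pos hb
      rw [hb1, sub_self, zero_mul, one_mul, zero_add]
      have := eventProbErase_le_of_big hL he he2 hν0 c hb
      have hC0 : 0 ≤ C := by linarith
      calc _ ≤ C * (Real.exp (3 * e) * eventProb L ν b) := by gcongr
        _ ≤ _ := by rw [← mul_assoc]; linarith
    · have hb0 : big b = 0 := if_neg hb
      have hcard : ((passing b).card : ℝ) ≤ 1 / e := by
        refine le_trans ?_ (not_lt.1 hb)
        exact_mod_cast card_passing_le b c
      have := le_eventProb_of_small hL hν1 hcard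
      rw [hb0, sub_zero, one_mul, zero_mul, mul_zero, add_zero]
      have h1 : 1 ≤ C * Real.exp (3 * e) :=
        one_le_mul_of_one_le_of_one_le hC1 (Real.one_le_exp (by positivity))
      nlinarith
  rw [prodExpect_add, prodExpect_const_mul] at hswap
  rw [← hswap] at hstep3
  have : C * prodExpect W (fun b => big b * eventProbErase L ν c b) =
      Real.exp e * prodExpect W (fun b => big b * eventProbErase L ν c b) +
      2 * x ^ 2 * e * Real.exp e * prodExpect W (fun b => big b * eventProbErase L ν c b) := by
    rw [hC]; ring
  linarith

end core

end PRSMA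
end

/-! ### Reduction of the mechanism to finitely many outcomes per run. -/

noncomputable section

theorem measurableSet_option_iff {α : Type*} [MeasurableSpace α] {s : Set (Option α)} :
    MeasurableSet s ↔ MeasurableSet (some ⁻¹' s) := Iff.rfl

theorem measurable_option_some {α : Type*} [MeasurableSpace α] :
    Measurable (some : α → Option α) := fun _ h => h

theorem measurable_option_of_some {α β : Type*} [MeasurableSpace α] [MeasurableSpace β]
    {f : Option α → β} (h : Measurable fun x => f (some x)) : Measurable f :=
  fun _ hs => h hs

theorem measurableSet_image_some {α : Type*} [MeasurableSpace α] {s : Set α}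
    (hs : MeasurableSet s) : MeasurableSet (some '' s) := by
  rw [measurableSet_option_iff, Set.preimage_image_eq _ (Option.some_injective α)]
  exact hs

instance discreteMeasurableSpace_option_bool : DiscreteMeasurableSpace (Option Bool) :=
  ⟨fun _ => measurableSet_option_iff.2 (MeasurableSet.of_discrete)⟩

namespace PRSMA

variable {K R : ℕ} {M : Type*}

open Classical in
/-- The type of a result of a run, relative to an event: failure, or whether the event occurs. -/
def outcome (E : Set (Option M)) (x : Option M) : Option Bool :=
  x.map fun y => decide (some y ∈ E)

@[simp]
theorem outcome_none (E : Set (Option M)) : outcome E none = none := rfl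

open Classical in
@[simp]
theorem outcome_some (E : Set (Option M)) (y : M) :
    outcome E (some y) = some (decide (some y ∈ E)) := rfl

theorem measurable_outcome [MeasurableSpace M] {E : Set (Option M)} (hE : MeasurableSet E) :
    Measurable (outcome E) := by
  classical
  refine measurable_option_of_some (measurable_option_some.comp (measurable_to_bool ?_))
  convert! measurable_option_some hE using 1
  ext y
  simp

theorem passing_outcome (E : Set (Option M)) (a : Fin K × Fin R → Option M) :
    passing (fun p => outcome E (a p)) = passing a := by
  ext i
  simp [mem_passing, outcome]

theorem measurable_passing [MeasurableSpace M] : Measurable[_, ⊤] (passing : (Fin K × Fin R → Option M) → _) := by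
  let _ : MeasurableSpace (Finset (Fin K)) := ⊤
  have h1 : Measurable fun a : Fin K × Fin R → Option M => fun p => outcome (∅ : Set (Option M)) (a p) :=
    measurable_pi_lambda _ fun p => (measurable_outcome MeasurableSet.empty).comp (measurable_pi_apply p)
  have h2 : Measurable (passing : (Fin K × Fin R → Option Bool) → Finset (Fin K)) :=
    Measurable.of_discrete
  simpa [Function.comp_def, passing_outcome] using h2.comp h1

theorem uniformMixture_apply {ι α : Type*} [MeasurableSpace α] (s : Finset ι) (ν : ι → Measure α)
    (E : Set α) : uniformMixture s ν E = (s.card : ℝ≥0∞)⁻¹ * ∑ i ∈ s, ν i E := by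
  simp [uniformMixture]

theorem isProbabilityMeasure_uniformMixture {ι α : Type*} [MeasurableSpace α] {s : Finset ι}
    (hs : s.Nonempty) (ν : ι → Measure α) [∀ i, IsProbabilityMeasure (ν i)] :
    IsProbabilityMeasure (uniformMixture s ν) := by
  constructor
  simp only [uniformMixture_apply, measure_univ, Finset.sum_const, nsmul_eq_mul, mul_one]
  exact ENNReal.inv_mul_cancel (by simpa using hs.ne_empty) (by simp)

theorem measurable_release [MeasurableSpace M] (e d : ℝ) :
    Measurable fun y : (Fin K × Fin R → Option M) × ℝ => release e d y.1 y.2 := by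
  classical
  let _ : MeasurableSpace (Finset (Fin K)) := ⊤
  have : DiscreteMeasurableSpace (Finset (Fin K)) := ⟨fun _ => trivial⟩
  -- With the finitely many passing sets `B` as a separate argument, each slice is visibly
  -- measurable.
  set G : Finset (Fin K) → (Fin K × Fin R → Option M) × ℝ → Measure (Option M) := fun B y =>
    if 1 / e * (1 + Real.log (1 / d)) < (B.card : ℝ) + y.2 ∧
      (B ×ˢ (Finset.univ : Finset (Fin R))).Nonempty then
    uniformMixture (B ×ˢ (Finset.univ : Finset (Fin R))) fun p => Measure.dirac (y.1 p)
    else Measure.dirac none with hG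
  have hGm : ∀ B, Measurable (G B) := by
    intro B
    refine Measurable.ite ?_ ?_ measurable_const
    · exact (measurableSet_lt measurable_const (measurable_snd.const_add (B.card : ℝ))).inter
        (MeasurableSet.const _)
    · refine Measure.measurable_of_measurable_coe _ fun E hE => ?_
      simp only [uniformMixture_apply]
      refine Measurable.const_mul (Finset.measurable_sum _ fun p _ => ?_) _
      exact (Measure.measurable_coe hE).comp
        (Measure.measurable_dirac.comp ((measurable_pi_apply p).comp measurable_fst))
  have h1 : Measurable fun x : Finset (Fin K) × ((Fin K × Fin R → Option M) × ℝ) => G x.1 x.2 :=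
    measurable_from_prod_countable_right hGm
  have h2 : (fun y : (Fin K × Fin R → Option M) × ℝ => release e d y.1 y.2) =
      (fun x : Finset (Fin K) × ((Fin K × Fin R → Option M) × ℝ) => G x.1 x.2) ∘
        fun y => (passing y.1, y) := by
    funext y
    simp only [release, hG, Function.comp_apply]
  rw [h2]
  exact h1.comp ((measurable_passing.comp measurable_fst).prodMk measurable_id)

theorem isProbabilityMeasure_release [MeasurableSpace M] (e d : ℝ) (a : Fin K × Fin R → Option M) (z : ℝ) :
    IsProbabilityMeasure (release e d a z) := by
  rw [release]
  split_ifs with h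
  · exact isProbabilityMeasure_uniformMixture h.2 _
  · infer_instance

/-- The probability that the noisy number of passing blocks exceeds the threshold and is positive,
when `T` blocks pass. -/
def releaseProb (e d : ℝ) (T : ℕ) : ℝ :=
  if T = 0 then 0 else exceedProb (1 / e) (1 / e * (1 + Real.log (1 / d))) T

theorem isReleaseProb_releaseProb {e d : ℝ} (he : 0 < e) (hd : 0 < d) (hd1 : d ≤ 1) :
    IsReleaseProb e d (releaseProb e d) := by
  have hb : 0 < 1 / e := by positivity
  have hpos : ∀ T, 1 ≤ T → releaseProb e d T =
      exceedProb (1 / e) (1 / e * (1 + Real.log (1 / d))) T := fun T hT => if_neg (by omega)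
  refine ⟨fun T => ?_, fun T => ?_, fun T hT => ?_, fun T hT => ?_, fun T hT => ?_, fun T hT => ?_⟩
  · rw [releaseProb]
    split_ifs
    exacts [le_rfl, exceedProb_nonneg _ _ _]
  · rw [releaseProb]
    split_ifs
    exacts [zero_le_one, exceedProb_le_one hb _ _]
  · rw [releaseProb]
    split_ifs
    exacts [by positivity, exceedProb_le_of_le he hd hd1 hT]
  · rw [hpos T hT, hpos _ (by omega)]
    exact exceedProb_mono hb _ (by simp)
  · rw [hpos T hT, hpos _ (by omega)]
    have := exceedProb_add_one_le hb (1 / e * (1 + Real.log (1 / d))) T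
    rw [one_div_one_div] at this
    exact_mod_cast this
  · rw [hpos T hT, hpos _ (by omega)]
    have := one_sub_exceedProb_le hb (1 / e * (1 + Real.log (1 / d))) T
    rw [one_div_one_div] at this
    exact_mod_cast this

open Classical in
-- All blocks have the same number of runs, so a uniform pair `(i, t)` hits the event with the
-- average of `hits` over passing blocks.
theorem lintegral_release [MeasurableSpace M] (hR : 0 < R) {e d : ℝ} (he : 0 < e)
    (a : Fin K × Fin R → Option M) {E : Set (Option M)} (hE : MeasurableSet E) :
    ∫⁻ z, release e d a z E ∂(laplaceMeasure (1 / e)) =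
      ENNReal.ofReal (eventProb (releaseProb e d) (if none ∈ E then 1 else 0)
        fun p => outcome E (a p)) := by
  have hb : 0 < 1 / e := by positivity
  have := isProbabilityMeasure_laplaceMeasure hb
  set ν : ℝ := if none ∈ E then 1 else 0 with hν
  have hdirac : Measure.dirac (none : Option M) E = ENNReal.ofReal ν := by
    rw [Measure.dirac_apply' _ hE, hν]
    by_cases h : none ∈ E <;> simp [h]
  rw [eventProb, passing_outcome]
  by_cases hB : passing a = ∅
  · simp [release, hB, releaseProb, hdirac, -one_div]
  have hcard : 0 < (passing a).card := Finset.card_pos.2 (Finset.nonempty_iff_ne_empty.2 hB)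
  have hne : (passing a ×ˢ (Finset.univ : Finset (Fin R))).Nonempty :=
    (Finset.nonempty_iff_ne_empty.2 hB).product ⟨⟨0, hR⟩, Finset.mem_univ _⟩
  set T := (passing a).card with hT
  set τ := 1 / e * (1 + Real.log (1 / d)) with hτ
  have hR' : (0 : ℝ) < R := by exact_mod_cast hR
  have hT' : (0 : ℝ) < T := by exact_mod_cast hcard
  set H := (∑ i ∈ passing a, hits (fun p => outcome E (a p)) i) / T with hH
  have hH0 : 0 ≤ H := sum_hits_div_nonneg _ _
  have hmix : uniformMixture (passing a ×ˢ (Finset.univ : Finset (Fin R)))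
      (fun p => Measure.dirac (a p)) E = ENNReal.ofReal H := by
    rw [uniformMixture_apply]
    have h1 : ∀ p ∈ passing a ×ˢ (Finset.univ : Finset (Fin R)), Measure.dirac (a p) E =
        ENNReal.ofReal (if outcome E (a p) = some true then 1 else 0) := by
      intro p hp
      obtain ⟨x, hx⟩ := Option.ne_none_iff_exists'.1
        (mem_passing.1 (Finset.mem_product.1 hp).1 p.2)
      rw [Measure.dirac_apply' _ hE, hx]
      by_cases h : some x ∈ E <;> simp [h]
    rw [Finset.sum_congr rfl h1, ← ENNReal.ofReal_sum_of_nonneg fun p _ => by positivity,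
      ← ENNReal.ofReal_natCast, ← ENNReal.ofReal_inv_of_pos (by
        rw [Finset.card_product, Finset.card_univ, Fintype.card_fin]; push_cast; positivity),
      ← ENNReal.ofReal_mul (by positivity), Finset.sum_product, Finset.card_product,
      Finset.card_univ, Fintype.card_fin, ← hT, hH]
    congr 1
    simp only [hits]
    rw [← Finset.sum_div]
    push_cast
    field_simp
  have hrel : ∀ z, release e d a z E =
      {z : ℝ | τ < T + z}.indicator (fun _ => ENNReal.ofReal H) z +
      {z : ℝ | τ < T + z}ᶜ.indicator (fun _ => ENNReal.ofReal ν) z := by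
    intro z
    by_cases hz : τ < T + z
    · rw [Set.indicator_of_mem (show z ∈ {z : ℝ | τ < T + z} from hz),
        Set.indicator_of_notMem (by simpa using hz), add_zero, release, if_pos ⟨hz, hne⟩, hmix]
    · rw [Set.indicator_of_notMem (by simpa using hz),
        Set.indicator_of_mem (show z ∈ {z : ℝ | τ < T + z}ᶜ from hz), zero_add, release,
        if_neg fun h => hz h.1, hdirac]
  have hms := measurableSet_exceed τ T
  have hν0 : 0 ≤ ν := by rw [hν]; positivity
  simp_rw [hrel]
  rw [lintegral_add_left (measurable_const.indicator hms), lintegral_indicator_const hms,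
    lintegral_indicator_const hms.compl, releaseProb, if_neg hcard.ne', exceedProb,
    ← probReal_compl_eq_one_sub hms,
    ENNReal.ofReal_add (mul_nonneg measureReal_nonneg hH0) (mul_nonneg measureReal_nonneg hν0),
    ENNReal.ofReal_mul measureReal_nonneg, ENNReal.ofReal_mul measureReal_nonneg,
    ofReal_measureReal, ofReal_measureReal, mul_comm, mul_comm (ENNReal.ofReal ν)]

/-- The law of the type of a result. -/
def outcomeWeight [MeasurableSpace M] (E : Set (Option M)) (ν : Measure (Option M)) (y : Option Bool) : ℝ :=
  ν.real (outcome E ⁻¹' {y})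

theorem outcomeWeight_nonneg [MeasurableSpace M] (E : Set (Option M)) (ν : Measure (Option M)) (y : Option Bool) :
    0 ≤ outcomeWeight E ν y := measureReal_nonneg

theorem sum_outcomeWeight [MeasurableSpace M] {E : Set (Option M)} (hE : MeasurableSet E) (ν : Measure (Option M))
    [IsProbabilityMeasure ν] : ∑ y, outcomeWeight E ν y = 1 := by
  simp only [outcomeWeight]
  rw [sum_measureReal_preimage_singleton _ fun y _ =>
    measurable_outcome hE (MeasurableSet.of_discrete)]
  simp

open Classical in
-- Only the outcome types of the runs matter, so the product law is pushed forward to a finite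
-- product.
theorem bind_release_apply [MeasurableSpace M] (hR : 0 < R) {e d : ℝ} (he : 0 < e) (hd : 0 < d) (hd1 : d ≤ 1)
    (ν : Fin K → Measure (Option M)) [∀ i, IsProbabilityMeasure (ν i)] {E : Set (Option M)}
    (hE : MeasurableSet E) :
    (((Measure.pi fun p : Fin K × Fin R => ν p.1).prod (laplaceMeasure (1 / e))).bind
      fun y => release e d y.1 y.2) E =
    ENNReal.ofReal (prodExpect (fun p : Fin K × Fin R => outcomeWeight E (ν p.1))
      (eventProb (releaseProb e d) (if none ∈ E then 1 else 0))) := by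
  have hb : 0 < 1 / e := by positivity
  have := isProbabilityMeasure_laplaceMeasure hb
  have hL := isReleaseProb_releaseProb he hd hd1
  set F : (Fin K × Fin R → Option Bool) → ℝ :=
    eventProb (releaseProb e d) (if none ∈ E then 1 else 0) with hF
  have hF0 : ∀ b, 0 ≤ F b := fun b =>
    add_nonneg (mul_nonneg (hL.nonneg _) (sum_hits_div_nonneg b _))
      (mul_nonneg (sub_nonneg.2 (hL.le_one _)) (by positivity))
  have hom := measurable_outcome hE
  rw [Measure.bind_apply hE (measurable_release e d).aemeasurable,
    lintegral_prod (fun y : (Fin K × Fin R → Option M) × ℝ => release e d y.1 y.2 E)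
      ((Measure.measurable_coe hE).comp (measurable_release e d)).aemeasurable]
  simp_rw [lintegral_release hR he _ hE]
  have h1 : ∫⁻ a, ENNReal.ofReal (F fun p => outcome E (a p))
        ∂(Measure.pi fun p : Fin K × Fin R => ν p.1) =
      ∫⁻ b, ENNReal.ofReal (F b)
        ∂((Measure.pi fun p : Fin K × Fin R => ν p.1).map fun a p => outcome E (a p)) := by
    have hm : Measurable fun (a : Fin K × Fin R → Option M) p => outcome E (a p) :=
      measurable_pi_lambda _ fun p => hom.comp (measurable_pi_apply p)
    rw [lintegral_map Measurable.of_discrete hm]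
  have : ∀ p : Fin K × Fin R, IsProbabilityMeasure ((ν p.1).map (outcome E)) :=
    fun p => Measure.isProbabilityMeasure_map hom.aemeasurable
  rw [h1, Measure.pi_map_pi fun p => hom.aemeasurable, lintegral_fintype, prodExpect,
    ENNReal.ofReal_sum_of_nonneg fun b _ =>
      mul_nonneg (Finset.prod_nonneg fun p _ => outcomeWeight_nonneg _ _ _) (hF0 b)]
  refine Finset.sum_congr rfl fun b _ => ?_
  rw [Measure.pi_singleton, ENNReal.ofReal_mul
    (Finset.prod_nonneg fun p _ => outcomeWeight_nonneg _ _ _), mul_comm,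
    ENNReal.ofReal_prod_of_nonneg fun p _ => outcomeWeight_nonneg _ _ _]
  congr 1
  refine Finset.prod_congr rfl fun p _ => ?_
  rw [Measure.map_apply hom MeasurableSet.of_discrete, outcomeWeight, ofReal_measureReal]

end PRSMA
end

/-! ### Runs with a certifiable oracle versus a perfect one. -/

noncomputable section

section oracle

variable {X Q M : Type*}

theorem OracleProgram.run_eq_some_of_extends {O : WeightedDataset X → Option Q}
    {O' : WeightedDataset X → Q} (h : ∀ wd q, O wd = some q → O' wd = q) :
    ∀ (p : OracleProgram X Q M) (y : M), p.run O = some y → p.run (fun wd => some (O' wd)) = some y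
  | .output _, _, hy => hy
  | .call wd next, y, hy => by
    simp only [OracleProgram.run] at hy ⊢
    cases hq : O wd with
    | none => simp [hq] at hy
    | some q =>
      rw [hq] at hy
      rw [h wd q hq]
      exact OracleProgram.run_eq_some_of_extends h (next q) y hy

variable [MeasurableSpace X] [MeasurableSpace Q] [MeasurableSpace M]

theorem measurable_getD {Y : Type*} [MeasurableSpace Y] {f : Y → Option Q} {g : Y → Q}
    (hf : Measurable f) (hg : Measurable g) : Measurable fun y => (f y).getD (g y) := by
  intro s hs
  have h : (fun y => (f y).getD (g y)) ⁻¹' s =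
      f ⁻¹' (some '' s) ∪ (f ⁻¹' {none} ∩ g ⁻¹' s) := by
    ext y
    cases hy : f y <;> simp [hy]
  rw [h]
  refine (hf (measurableSet_image_some hs)).union ((hf ?_).inter (hg hs))
  rw [measurableSet_option_iff]
  convert! MeasurableSet.empty using 1
  ext; simp

theorem OracleAlgorithm.isProbabilityMeasure_law {k : ℕ} (A : OracleAlgorithm X Q M k)
    {O : WeightedDataset X → Option Q} (hO : Measurable O) (S : Fin k → X) :
    IsProbabilityMeasure (A.law O S) := by
  let _ := A.seedSpace
  have := A.seedProb
  exact Measure.isProbabilityMeasure_map (A.measurable_run O hO S).aemeasurable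

theorem OracleAlgorithm.law_apply {k : ℕ} (A : OracleAlgorithm X Q M k)
    {O : WeightedDataset X → Option Q} (hO : Measurable O) (S : Fin k → X) {E : Set (Option M)}
    (hE : MeasurableSet E) :
    A.law O S E = @DFunLike.coe _ _ _ (@Measure.instFunLike _ A.seedSpace) A.seedLaw
      {ω | (A.program ω S).run O ∈ E} := by
  let _ := A.seedSpace
  exact Measure.map_apply (A.measurable_run O hO S) hE

theorem OracleEquivalent.isProbabilityMeasure {ev : Q → X → Bool}
    (hperfect : ∃ Ostar : WeightedDataset X → Q, Measurable Ostar ∧ IsPerfectOracle ev Ostar)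
    {A : ∀ k, OracleAlgorithm X Q M k} {P : Mechanism X M} (h : OracleEquivalent ev A P) (k : ℕ)
    (S : Fin k → X) : IsProbabilityMeasure (P k S) := by
  obtain ⟨O, hO, hO'⟩ := hperfect
  have h1 := h O hO hO' k S
  have := (A k).isProbabilityMeasure_law (measurable_option_some.comp hO) S
  have h2 : (P k S).map some Set.univ = 1 := by
    rw [← h1]; exact measure_univ (μ := (A k).law (some ∘ O) S)
  rw [Measure.map_apply measurable_option_some MeasurableSet.univ] at h2
  exact ⟨h2⟩

/-- Answering failed calls by `Ostar` turns `O` into a perfect oracle `O'`. With the same seed, a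
run with `O` either fails or gives the output of the run with `O'`. -/
theorem OracleEquivalent.law_bounds {ev : Q → X → Bool}
    (hperfect : ∃ Ostar : WeightedDataset X → Q, Measurable Ostar ∧ IsPerfectOracle ev Ostar)
    {A : ∀ k, OracleAlgorithm X Q M k} {P : Mechanism X M} (h : OracleEquivalent ev A P)
    {O : WeightedDataset X → Option Q} (hOm : Measurable O) (hO : IsCertifiableOracle ev O)
    (k : ℕ) (S : Fin k → X) {E : Set (Option M)} (hE : MeasurableSet E) :
    PRSMA.outcomeWeight E ((A k).law O S) (some true) ≤ (P k S).real (some ⁻¹' E) ∧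
    (P k S).real (some ⁻¹' E) ≤ PRSMA.outcomeWeight E ((A k).law O S) (some true) +
      PRSMA.outcomeWeight E ((A k).law O S) none := by
  have hP := h.isProbabilityMeasure hperfect k S
  obtain ⟨Ostar, hOsm, hOs⟩ := hperfect
  set O' : WeightedDataset X → Q := fun wd => (O wd).getD (Ostar wd) with hO'
  have hO'm : Measurable O' := measurable_getD hOm hOsm
  have hext : ∀ wd q, O wd = some q → O' wd = q := fun wd q hq => by simp [hO', hq]
  have hO'p : IsPerfectOracle ev O' := by
    intro wd
    cases hq : O wd with
    | none => simpa [hO', hq] using hOs wd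
    | some q => simpa [hO', hq] using hO wd q hq
  have hrun := fun ω => OracleProgram.run_eq_some_of_extends hext ((A k).program ω S)
  have := (A k).isProbabilityMeasure_law hOm S
  have hpre : PRSMA.outcome E ⁻¹' {some true} = some '' (some ⁻¹' E) := by
    ext y
    cases y <;> simp
  have hpre' : PRSMA.outcome E ⁻¹' {none} = ({none} : Set (Option M)) := by
    ext y
    cases y <;> simp
  have hsE : MeasurableSet (some '' (some ⁻¹' E) : Set (Option M)) :=
    measurableSet_image_some (measurable_option_some hE)
  have hPE : P k S (some ⁻¹' E) = (A k).law (fun wd => some (O' wd)) S (some '' (some ⁻¹' E)) := by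
    rw [h O' hO'm hO'p k S, Measure.map_apply measurable_option_some hsE,
      Set.preimage_image_eq _ (Option.some_injective M)]
  have hO's : Measurable fun wd => some (O' wd) := measurable_option_some.comp hO'm
  have hnone : MeasurableSet ({none} : Set (Option M)) :=
    hpre' ▸ PRSMA.measurable_outcome hE MeasurableSet.of_discrete
  rw [PRSMA.outcomeWeight, PRSMA.outcomeWeight, hpre, hpre']
  constructor
  · refine ENNReal.toReal_mono (measure_ne_top _ _) ?_
    rw [hPE, (A k).law_apply hOm S hsE,
      (A k).law_apply hO's S hsE]
    let _ := (A k).seedSpace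
    refine measure_mono fun ω hω => ?_
    obtain ⟨y, hy, hyω⟩ := hω
    exact ⟨y, hy, (hrun ω y hyω.symm).symm⟩
  · refine (ENNReal.toReal_mono ?_ ?_).trans (measureReal_union_le _ _)
    · exact measure_ne_top _ _
    rw [hPE, (A k).law_apply hO's S hsE,
      (A k).law_apply hOm S (hsE.union hnone)]
    let _ := (A k).seedSpace
    refine measure_mono fun ω hω => ?_
    obtain ⟨y, hy, hyω⟩ := hω
    cases hr : ((A k).program ω S).run O with
    | none => exact Or.inr hr
    | some y' =>
      left
      have := (hrun ω y' hr).symm.trans hyω.symm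
      rw [Option.some.injEq] at this
      subst this
      exact ⟨y', hy, hr.symm⟩

end oracle

/-! ### Parameters, blocks and the law of the mechanism. -/

namespace PRSMA

theorem numBlocks_pos {e d : ℝ} (he : 0 < e) (hd : 0 < d) (hd2 : d ≤ 1 / 2) :
    0 < numBlocks e d := by
  have : 0 ≤ Real.log (2 / d) := Real.log_nonneg (by rw [le_div_iff₀ hd]; linarith)
  exact Nat.ceil_pos.2 (by positivity)

theorem log_div_pos {K d : ℝ} (hK : 1 ≤ K) (hd : 0 < d) (hd2 : d ≤ 1 / 2) :
    0 < Real.log (K / d) :=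
  Real.log_pos (by rw [lt_div_iff₀ hd]; linarith)

theorem numRuns_pos {e d : ℝ} (he : 0 < e) (hd : 0 < d) (hd2 : d ≤ 1 / 2) :
    0 < numRuns e d := by
  have h : (1 : ℝ) ≤ numBlocks e d := by exact_mod_cast numBlocks_pos he hd hd2
  exact Nat.ceil_pos.2 (div_pos (log_div_pos h hd hd2) hd)

/-- `1 - f ≤ exp (-d)`, and the number of runs is at least `log (K / d) / d`. -/
theorem one_sub_pow_numRuns_le {e d : ℝ} (he : 0 < e) (hd : 0 < d) (hd2 : d ≤ 1 / 2) {f : ℝ}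
    (hf : d < f) (hf1 : f ≤ 1) : (1 - f) ^ numRuns e d ≤ d / numBlocks e d := by
  have hK : (0 : ℝ) < numBlocks e d := by exact_mod_cast numBlocks_pos he hd hd2
  have h1 : 1 - f ≤ Real.exp (-d) := by linarith [Real.add_one_le_exp (-d)]
  have h2 : Real.log (numBlocks e d / d) ≤ numRuns e d * d :=
    (div_le_iff₀ hd).1 (Nat.le_ceil _)
  calc (1 - f) ^ numRuns e d ≤ Real.exp (-d) ^ numRuns e d := by
        gcongr
    _ = Real.exp (-(numRuns e d * d)) := by rw [← Real.exp_nat_mul]; ring_nf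
    _ ≤ Real.exp (-Real.log (numBlocks e d / d)) := Real.exp_le_exp.2 (by linarith)
    _ = d / numBlocks e d := by
        rw [Real.exp_neg, Real.exp_log (by positivity), inv_div]

/-- The blocks use disjoint positions, so the changed entry lies in at most one of them. If it is
discarded, any `c` serves. -/
theorem exists_forall_block_eq {X : Type*} {n K : ℕ} (hK : 0 < K) {S S' : Fin n → X}
    (h : Neighbors S S') (σ : Equiv.Perm (Fin n)) :
    ∃ c : Fin K, ∀ i, i ≠ c → block K S σ i = block K S' σ i := by
  obtain ⟨j₀, hj₀⟩ := h
  have key : ∀ i : Fin K, block K S σ i ≠ block K S' σ i →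
      ∃ j : Fin (n / K), σ ⟨i * (n / K) + j, block_index_lt i j⟩ = j₀ := by
    intro i hi
    by_contra! hne
    exact hi (funext fun j => hj₀ _ (hne j))
  by_cases hc : ∃ c : Fin K, block K S σ c ≠ block K S' σ c
  · obtain ⟨c, hc⟩ := hc
    refine ⟨c, fun i hi => ?_⟩
    by_contra hne
    obtain ⟨j, hj⟩ := key c hc
    obtain ⟨j', hj'⟩ := key i hne
    have h1 := σ.injective (hj'.trans hj.symm)
    simp only [Fin.mk.injEq] at h1
    apply hi
    have hm : 0 < n / K := j.pos
    have h2 := congrArg (fun x => x / (n / K)) h1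
    rw [mul_comm (i : ℕ), mul_comm (c : ℕ), Nat.mul_add_div hm, Nat.mul_add_div hm,
      Nat.div_eq_of_lt j.2, Nat.div_eq_of_lt j'.2] at h2
    exact Fin.ext (by simpa using h2)
  · push Not at hc
    exact ⟨⟨0, hK⟩, fun i _ => hc i⟩

section mechanism

variable {X Q M : Type*} [MeasurableSpace X] [MeasurableSpace Q] [MeasurableSpace M]

theorem isProbabilityMeasure_mechanism (A : ℝ → ∀ k, OracleAlgorithm X Q M k)
    {O : WeightedDataset X → Option Q} (hO : Measurable O) {e : ℝ} (he : 0 < e) (d : ℝ) (n : ℕ)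
    (S : Fin n → X) : IsProbabilityMeasure (mechanism A O e d n S) := by
  have := isProbabilityMeasure_laplaceMeasure (b := 1 / e) (by positivity)
  have h1 : ∀ S : Fin (n / numBlocks e d) → X, IsProbabilityMeasure
      ((A (innerEps e d n) (n / numBlocks e d)).law O S) :=
    fun S => (A _ _).isProbabilityMeasure_law hO S
  have h2 : ∀ σ : Equiv.Perm (Fin n), IsProbabilityMeasure
      (((Measure.pi fun p : Fin (numBlocks e d) × Fin (numRuns e d) =>
          (A (innerEps e d n) (n / numBlocks e d)).law O (block (numBlocks e d) S σ p.1)).prod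
        (laplaceMeasure (1 / e))).bind fun y => release e d y.1 y.2) := fun σ => by
    exact isProbabilityMeasure_bind (measurable_release e d).aemeasurable
      (Filter.Eventually.of_forall fun y => isProbabilityMeasure_release e d y.1 y.2)
  exact isProbabilityMeasure_uniformMixture Finset.univ_nonempty _

open Classical in
theorem mechanism_apply (A : ℝ → ∀ k, OracleAlgorithm X Q M k)
    {O : WeightedDataset X → Option Q} (hO : Measurable O) {e d : ℝ} (he : 0 < e) (hd : 0 < d)
    (hd2 : d ≤ 1 / 2) (n : ℕ) (S : Fin n → X) {E : Set (Option M)} (hE : MeasurableSet E) :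
    mechanism A O e d n S E = ENNReal.ofReal ((Fintype.card (Equiv.Perm (Fin n)) : ℝ)⁻¹ *
      ∑ σ, prodExpect (fun p : Fin (numBlocks e d) × Fin (numRuns e d) =>
        outcomeWeight E ((A (innerEps e d n) (n / numBlocks e d)).law O
          (block (numBlocks e d) S σ p.1)))
        (eventProb (releaseProb e d) (if none ∈ E then 1 else 0))) := by
  have h1 : ∀ S : Fin (n / numBlocks e d) → X, IsProbabilityMeasure
      ((A (innerEps e d n) (n / numBlocks e d)).law O S) :=
    fun S => (A _ _).isProbabilityMeasure_law hO S
  have hL := isReleaseProb_releaseProb he hd (hd2.trans (by norm_num))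
  have hN : (0 : ℝ) < Fintype.card (Equiv.Perm (Fin n)) := by exact_mod_cast Fintype.card_pos
  rw [mechanism, uniformMixture_apply, Finset.card_univ, ENNReal.ofReal_mul (by positivity),
    ENNReal.ofReal_inv_of_pos hN, ENNReal.ofReal_natCast, ENNReal.ofReal_sum_of_nonneg]
  · congr 1
    exact Finset.sum_congr rfl fun σ _ => bind_release_apply (numRuns_pos he hd hd2) he hd
      (hd2.trans (by norm_num)) (fun i => (A (innerEps e d n) (n / numBlocks e d)).law O
          (block (numBlocks e d) S σ i)) hE
  · intro σ _
    refine prodExpect_nonneg (fun p y => outcomeWeight_nonneg _ _ _) fun b => ?_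
    exact add_nonneg (mul_nonneg (hL.nonneg _) (sum_hits_div_nonneg b _))
      (mul_nonneg (sub_nonneg.2 (hL.le_one _)) (by positivity))

end mechanism

end PRSMA
end

/-! ### Choice of constants and average over arrangements. -/

noncomputable section

namespace PRSMA

/-- The exponent in the concentration bound for blocks of size `⌊n/K⌋`. -/
theorem concentration_exponent_le {e d : ℝ} (he : 0 < e) (hd : 0 < d) (hd2 : d ≤ 1 / 2) {n : ℕ}
    (hn : 0 < n) :
    ((n / numBlocks e d : ℕ) : ℝ) * ((8 / 3 * Real.log (2 * numBlocks e d / d)) ^ 2 *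
      (3 * innerEps e d n) ^ 2 / 8) ≤ Real.log (2 * numBlocks e d / d) := by
  have hK : (1 : ℝ) ≤ numBlocks e d := by exact_mod_cast numBlocks_pos he hd hd2
  have hl : 0 < Real.log (2 * numBlocks e d / d) := log_div_pos (by linarith) hd hd2
  have hn' : (0 : ℝ) < n := by exact_mod_cast hn
  have hm : ((n / numBlocks e d : ℕ) : ℝ) ≤ n / numBlocks e d := Nat.cast_div_le
  rw [innerEps, mul_pow 3, div_pow, Real.sq_sqrt (by positivity)]
  set l := Real.log (2 * numBlocks e d / d)
  set r : ℝ := n / numBlocks e d with hr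
  have hr0 : 0 < r := by positivity
  calc _ ≤ r * ((8 / 3 * l) ^ 2 * (3 ^ 2 * (1 ^ 2 / (8 * r * l))) / 8) := by gcongr
    _ = l := by field_simp

theorem mechanism_privacy {X Q M : Type*} [MeasurableSpace X] [MeasurableSpace Q]
    [MeasurableSpace M] (ev : Q → X → Bool)
    (hperfect : ∃ Ostar : WeightedDataset X → Q, Measurable Ostar ∧ IsPerfectOracle ev Ostar)
    (A : ℝ → ∀ k, OracleAlgorithm X Q M k)
    (hA : ∀ ε' : ℝ, 0 < ε' → IsNonRobustlyPrivate ev ε' (A ε'))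
    (O : WeightedDataset X → Option Q) (hOmeas : Measurable O) (hO : IsCertifiableOracle ev O)
    {e d : ℝ} (he : 0 < e) (he2 : e ≤ 1 / 2) (hd : 0 < d) (hd2 : d ≤ 1 / 2) :
    IsDifferentiallyPrivate (62 * e) (11 * d) (mechanism A O e d) := by
  classical
  intro n S S' hSS' E hE
  have hn : 0 < n := hSS'.choose.pos
  have hn' : (0 : ℝ) < n := by exact_mod_cast hn
  have hKpos := numBlocks_pos he hd hd2
  have hK : (1 : ℝ) ≤ numBlocks e d := by exact_mod_cast hKpos
  have hl : 0 < Real.log (2 * numBlocks e d / d) := log_div_pos (by linarith) hd hd2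
  have hinner : 0 < innerEps e d n := by
    rw [innerEps]
    positivity
  have hVle := concentration_exponent_le he hd hd2 hn
  have hpass := fun f => one_sub_pow_numRuns_le (f := f) he hd hd2
  rw [mechanism_apply A hOmeas he hd hd2 n S hE, mechanism_apply A hOmeas he hd hd2 n S' hE]
  obtain ⟨P, hP, hPA⟩ := hA _ hinner
  set K := numBlocks e d with hKdef
  set m := n / K with hm
  set l := Real.log (2 * K / d) with hldef
  set law : (Fin m → X) → Measure (Option M) := fun T => (A (innerEps e d n) m).law O T with hlaw
  have hlawprob : ∀ T, IsProbabilityMeasure (law T) :=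
    fun T => (A _ _).isProbabilityMeasure_law hOmeas T
  have hPprob : ∀ T : Fin m → X, IsProbabilityMeasure (P m T) :=
    fun T => hPA.isProbabilityMeasure hperfect m T
  have hbounds := fun T : Fin m → X => hPA.law_bounds hperfect hOmeas hO m T hE
  have hE' : MeasurableSet (some ⁻¹' E : Set M) := measurable_option_some hE
  -- concentration
  have hl1 : 1 ≤ 8 / 3 * l := by
    have h4 : Real.log 4 ≤ l := by
      refine Real.log_le_log (by norm_num) ?_
      rw [le_div_iff₀ hd]
      linarith
    have h2 : Real.log 4 = 2 * Real.log 2 := by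
      rw [show (4 : ℝ) = 2 ^ 2 by norm_num, Real.log_pow]; norm_num
    have := Real.log_two_gt_d9
    linarith
  -- With parameter `8 / 3 * l` and `t = 3 / 4` the tail exponent is `2 * l`, while the variance
  -- term is at most `l`. This leaves `exp (-l) = d / (2 * K)`, enough for a sum over `K` blocks;
  -- the upward error has an extra factor `exp (3 / 4)`.
  obtain ⟨q, U, D, hq1, hU, hD, hUD⟩ := exists_reference (Nat.div_le_self n K) hn
    (fun g : Fin m → Fin n => P m fun j => S (g j)) hinner.le
    (fun g g' j h E hE => by
      have := hP m (fun j => S (g j)) (fun j => S (g' j))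
        ⟨j, fun k hk => by simp only [h k hk]⟩ E hE
      rwa [ENNReal.ofReal_zero, add_zero] at this) hl1 (t := 3 / 4) hE'
  set x : ℝ := Real.exp (3 / 4) with hx
  set N : ℝ := (Fintype.card (Equiv.Perm (Fin n)) : ℝ) with hN
  have hNpos : 0 < N := by rw [hN]; exact_mod_cast Fintype.card_pos
  have hexpl : Real.exp (-l) = d / (2 * K) := by
    rw [hldef, Real.exp_neg, Real.exp_log (by positivity), inv_div]
  set pos : Equiv.Perm (Fin n) → Fin K → Fin m → Fin n :=
    fun σ i j => σ ⟨i * m + j, block_index_lt i j⟩ with hpos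
  have hblock : ∀ σ i, block K S σ i = fun j => S (pos σ i j) := fun σ i => rfl
  have him : ∀ i : Fin K, i * m + m ≤ n := fun i =>
    calc (i : ℕ) * m + m = ((i : ℕ) + 1) * m := by ring
      _ ≤ K * m := Nat.mul_le_mul_right _ i.2
      _ ≤ n := Nat.mul_div_le n K
  have hUsum : ∀ i, ∑ σ, U (pos σ i) ≤ ENNReal.ofReal (N * (x * (d / (2 * K)))) := by
    intro i
    refine (hUD (i * m) (him i)).1.trans (ENNReal.ofReal_le_ofReal ?_)
    rw [hx, ← hexpl, ← Real.exp_add]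
    gcongr
    linarith
  have hDsum : ∀ i, ∑ σ, D (pos σ i) ≤ ENNReal.ofReal (N * (d / (2 * K))) := by
    intro i
    refine (hUD (i * m) (him i)).2.trans (ENNReal.ofReal_le_ofReal ?_)
    rw [← hexpl]
    gcongr
    linarith
  have hqtop : q ≠ ∞ := (hq1.trans_lt ENNReal.one_lt_top).ne
  have hUtop : ∀ σ i, U (pos σ i) ≠ ∞ := fun σ i => ne_top_of_le_ne_top ENNReal.ofReal_ne_top
    ((Finset.single_le_sum (f := fun σ => U (pos σ i)) (fun _ _ => zero_le)
      (Finset.mem_univ σ)).trans (hUsum i))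
  have hDtop : ∀ σ i, D (pos σ i) ≠ ∞ := fun σ i => ne_top_of_le_ne_top ENNReal.ofReal_ne_top
    ((Finset.single_le_sum (f := fun σ => D (pos σ i)) (fun _ _ => zero_le)
      (Finset.mem_univ σ)).trans (hDsum i))
  have hx0 : 0 < x := Real.exp_pos _
  have hUsum' : ∀ i, ∑ σ, (U (pos σ i)).toReal ≤ N * (x * (d / (2 * K))) := by
    intro i
    rw [← ENNReal.toReal_sum fun σ _ => hUtop σ i]
    exact ENNReal.toReal_le_of_le_ofReal (by positivity) (hUsum i)
  have hDsum' : ∀ i, ∑ σ, (D (pos σ i)).toReal ≤ N * (d / (2 * K)) := by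
    intro i
    rw [← ENNReal.toReal_sum fun σ _ => hDtop σ i]
    exact ENNReal.toReal_le_of_le_ofReal (by positivity) (hDsum i)
  set mr : Equiv.Perm (Fin n) → Fin K → ℝ := fun σ i => (P m (block K S σ i)).real (some ⁻¹' E)
    with hmr
  have hU' : ∀ σ i, mr σ i ≤ x * q.toReal + (U (pos σ i)).toReal := by
    intro σ i
    have h1 := ENNReal.toReal_mono
      (ENNReal.add_ne_top.2 ⟨ENNReal.mul_ne_top ENNReal.ofReal_ne_top hqtop, hUtop σ i⟩)
      (hU (pos σ i))
    rwa [ENNReal.toReal_add (ENNReal.mul_ne_top ENNReal.ofReal_ne_top hqtop) (hUtop σ i),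
      ENNReal.toReal_mul, ENNReal.toReal_ofReal hx0.le] at h1
  have hD' : ∀ σ i, q.toReal ≤ x * mr σ i + (D (pos σ i)).toReal := by
    intro σ i
    have h0 : P m (fun j => S (pos σ i j)) (some ⁻¹' E) ≠ ∞ := measure_ne_top _ _
    have h1 := ENNReal.toReal_mono
      (ENNReal.add_ne_top.2 ⟨ENNReal.mul_ne_top ENNReal.ofReal_ne_top h0, hDtop σ i⟩)
      (hD (pos σ i))
    rwa [ENNReal.toReal_add (ENNReal.mul_ne_top ENNReal.ofReal_ne_top h0) (hDtop σ i),
      ENNReal.toReal_mul, ENNReal.toReal_ofReal hx0.le] at h1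
  have hx2 : x ^ 2 ≤ 5 := by
    have h1 : (x ^ 2) ^ 2 = Real.exp 1 ^ 3 := by
      rw [hx, ← Real.exp_nat_mul, ← Real.exp_nat_mul, ← Real.exp_nat_mul]
      norm_num
    have h2 : Real.exp 1 ^ 3 ≤ (2.72 : ℝ) ^ 3 := by
      have := Real.exp_one_lt_d9
      gcongr
      linarith
    nlinarith [sq_nonneg x]
  have hx4 : x ≤ 4 := by nlinarith
  set ν : ℝ := if none ∈ E then 1 else 0 with hν
  have hν0 : 0 ≤ ν := by rw [hν]; positivity
  have hν1 : ν ≤ 1 := by rw [hν]; split_ifs <;> norm_num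
  set out : (Fin n → X) → Equiv.Perm (Fin n) → ℝ := fun T σ =>
    prodExpect (fun p : Fin K × Fin (numRuns e d) => outcomeWeight E (law (block K T σ p.1)))
      (eventProb (releaseProb e d) ν) with hout
  have hL := isReleaseProb_releaseProb he hd (hd2.trans (by norm_num))
  have hout0 : ∀ T σ, 0 ≤ out T σ := fun T σ =>
    prodExpect_nonneg (fun p y => outcomeWeight_nonneg _ _ _) fun b =>
      add_nonneg (mul_nonneg (hL.nonneg _) (sum_hits_div_nonneg b _))
        (mul_nonneg (sub_nonneg.2 (hL.le_one _)) hν0)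
  have hσ : ∀ σ, out S σ ≤ Real.exp (62 * e) * out S' σ +
      (7 * d + 4 * (∑ i, (D (pos σ i)).toReal) + ∑ i, (U (pos σ i)).toReal) := by
    intro σ
    obtain ⟨c, hc⟩ := exists_forall_block_eq hKpos hSS' σ
    have hmain := prodExpect_eventProb_le (numRuns_pos he hd hd2) he he2 hd hd2 hL hν0 hν1
      (w := fun i => outcomeWeight E (law (block K S σ i)))
      (w' := fun i => outcomeWeight E (law (block K S' σ i)))
      (fun i y => outcomeWeight_nonneg _ _ _) (fun i => sum_outcomeWeight hE _)
      (fun i y => outcomeWeight_nonneg _ _ _) (fun i => sum_outcomeWeight hE _) c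
      (fun i hi => by simp only [hc i hi]) hpass (m := mr σ)
      (fun i => (hbounds _).1) (fun i => (hbounds _).2) hx0.le
      (U := (U (pos σ c)).toReal) (D := fun i => (D (pos σ i)).toReal)
      ENNReal.toReal_nonneg (fun i => ENNReal.toReal_nonneg) (hU' σ c) (hD' σ)
    refine hmain.trans (add_le_add ?_ ?_)
    · refine mul_le_mul_of_nonneg_right (Real.exp_le_exp.2 ?_) (hout0 S' σ)
      -- `4 + 2 * x ^ 2 ≤ 14`, well below `62`.
      nlinarith
    -- The block `c` depends on `σ`, so its error is replaced by the sum over all blocks before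
    -- averaging.
    · have h1 : (U (pos σ c)).toReal ≤ ∑ i, (U (pos σ i)).toReal :=
        Finset.single_le_sum (f := fun i => (U (pos σ i)).toReal)
          (fun _ _ => ENNReal.toReal_nonneg) (Finset.mem_univ c)
      have h2 : 0 ≤ ∑ i, (D (pos σ i)).toReal :=
        Finset.sum_nonneg fun _ _ => ENNReal.toReal_nonneg
      have h3 : x ^ 2 * d ≤ 5 * d := by gcongr
      have h4 : x * ∑ i, (D (pos σ i)).toReal ≤ 4 * ∑ i, (D (pos σ i)).toReal := by gcongr
      have h5 : 0 ≤ x ^ 2 * d + x * (∑ i, (D (pos σ i)).toReal) + (U (pos σ c)).toReal := by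
        have : 0 ≤ (U (pos σ c)).toReal := ENNReal.toReal_nonneg
        positivity
      have h6 : 2 * e ≤ 1 := by linarith
      have h7 := mul_le_of_le_one_left h5 h6
      linarith
  have hsumD : ∑ σ, ∑ i, (D (pos σ i)).toReal ≤ N * (d / 2) := by
    rw [Finset.sum_comm]
    calc _ ≤ ∑ _i : Fin K, N * (d / (2 * K)) := Finset.sum_le_sum fun i _ => hDsum' i
      _ = _ := by
        rw [Finset.sum_const, Finset.card_univ, Fintype.card_fin, nsmul_eq_mul]
        field_simp
  have hsumU : ∑ σ, ∑ i, (U (pos σ i)).toReal ≤ N * (x * (d / 2)) := by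
    rw [Finset.sum_comm]
    calc _ ≤ ∑ _i : Fin K, N * (x * (d / (2 * K))) := Finset.sum_le_sum fun i _ => hUsum' i
      _ = _ := by
        rw [Finset.sum_const, Finset.card_univ, Fintype.card_fin, nsmul_eq_mul]
        field_simp
  -- The additive errors are `7 * d`, then `4 * (d / 2)` from `D`, and `x * (d / 2) ≤ 2 * d` from
  -- `U`.
  have hfinal : N⁻¹ * ∑ σ, out S σ ≤ Real.exp (62 * e) * (N⁻¹ * ∑ σ, out S' σ) + 11 * d := by
    rw [inv_mul_le_iff₀ hNpos]
    calc ∑ σ, out S σ ≤ ∑ σ, (Real.exp (62 * e) * out S' σ +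
          (7 * d + 4 * (∑ i, (D (pos σ i)).toReal) + ∑ i, (U (pos σ i)).toReal)) :=
          Finset.sum_le_sum fun σ _ => hσ σ
      _ = Real.exp (62 * e) * ∑ σ, out S' σ + (N * (7 * d) +
          4 * (∑ σ, ∑ i, (D (pos σ i)).toReal) + ∑ σ, ∑ i, (U (pos σ i)).toReal) := by
          simp only [Finset.sum_add_distrib, ← Finset.mul_sum, Finset.sum_const, Finset.card_univ,
            nsmul_eq_mul, ← hN]
          ring
      _ ≤ Real.exp (62 * e) * ∑ σ, out S' σ + N * (11 * d) := by
          have h1 : N * (x * (d / 2)) ≤ N * (4 * (d / 2)) := by gcongr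
          linarith
      _ = _ := by field_simp
  have hS'0 : 0 ≤ N⁻¹ * ∑ σ, out S' σ :=
    mul_nonneg (by positivity) (Finset.sum_nonneg fun σ _ => hout0 S' σ)
  rw [← ENNReal.ofReal_mul (Real.exp_pos _).le, ← ENNReal.ofReal_add (by positivity) (by positivity)]
  exact ENNReal.ofReal_le_ofReal hfinal

end PRSMA

end

theorem theorem3 {X Q M : Type*} [MeasurableSpace X] [MeasurableSpace Q] [MeasurableSpace M]
    (ev : Q → X → Bool)
    (hperfect : ∃ Ostar : WeightedDataset X → Q, Measurable Ostar ∧ IsPerfectOracle ev Ostar)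
    (A : ℝ → ∀ k, OracleAlgorithm X Q M k)
    (hA : ∀ ε' : ℝ, 0 < ε' → IsNonRobustlyPrivate ev ε' (A ε'))
    (O : WeightedDataset X → Option Q) (hOmeas : Measurable O) (hO : IsCertifiableOracle ev O)
    (ε δ : ℝ) (hε : 0 < ε) (hδ : 0 < δ) (hε_half : ε / 62 ≤ 1 / 2) (hδ_half : δ / 11 ≤ 1 / 2) :
    (∀ (n : ℕ) (S : Fin n → X),
        IsProbabilityMeasure (PRSMA.mechanism A O (ε / 62) (δ / 11) n S)) ∧
      IsDifferentiallyPrivate ε δ (PRSMA.mechanism A O (ε / 62) (δ / 11)) := by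
  have he : 0 < ε / 62 := by positivity
  refine ⟨fun n S => PRSMA.isProbabilityMeasure_mechanism A hOmeas he _ n S, ?_⟩
  have h := PRSMA.mechanism_privacy ev hperfect A hA O hOmeas hO he hε_half
    (show 0 < δ / 11 by positivity) hδ_half
  rwa [mul_div_cancel₀ ε (by norm_num), mul_div_cancel₀ δ (by norm_num)] at h
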